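/- Graphs are finite-edge multigraphs (loops and parallel edges allowed) with edge set $\{0,\dots,m-1\}$; a cycle is identified with its edge set, and its length is its number of edges. The graphic matroid of $G$ has the edges as its ground set, and a set of edges is independent if it contains no cycle; its bases are the spanning forests of $G$. A deterministic parallel algorithm on $m$ elements is a parallel decision tree: in each adaptive round it submits a list of subsets of $\{0,\dots,m-1\}$ to an independence oracle, chosen as a function of the answers in earlier rounds only; the oracle tells for each of them whether it is independent; at a leaf the algorithm outputs a set. The algorithm is non-uniform, i.e. there may be a different tree for each $m$. For positive integers $j,\ell$ call a family $\mathcal B$ of subsets of $\{0,\dots,j-1\}$ universal for $(j,\ell)$ if, for every graph $G$ with edge set $\{0,\dots,j-1\}$ and minimum cycle length $\ell$ and every cycle $C$ of $G$ with $\ell\le |C|\le 1.01\,\ell$, there is $S\in\mathcal B$ such that $C$ is the only cycle of $G$ contained in $S$. Theorem. There are polynomials $s,q$ with coefficients in $\mathbb N$, a constant $k$, and a function $r(m)=O(\log m)$ such that the following holds. (1) There are families $\mathcal B^{j,\ell}$, one for each edge count $j$ and each minimum cycle length $\ell$, such that $\mathcal B^{j,\ell}$ is universal for $(j,\ell)$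 and $|\mathcal B^{j,\ell}|\le s(j)$. (2) Given any families $\mathcal B^{j,\ell}$ as in (1), there is for every $m$ a deterministic parallel algorithm that, for every graph with edge set $\{0,\dots,m-1\}$, outputs a spanning forest (a basis of the graphic matroid) using only independence queries, at most $r(m)$ adaptive rounds, and at most $q(m)$ non-adaptive queries in each round. Moreover, each set that it queries either has at most $k$ elements, or is obtained as follows: take a set $E\subseteq\{0,\dots,m-1\}$ of edges, some $\ell\in\{1,\dots,m\}$ and some $S\in\mathcal B^{|E|,\ell}$, carry $S$ over to $E$ by the increasing bijection $\{0,\dots,|E|-1\}\to E$, and remove at most one edge. -/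

import Mathlib

open Filter Asymptotics

universe u

namespace Graph

variable {V β : Type*} {G : Graph V β}

/-- `C` is the edge set of a cycle of the multigraph `G`: there are `n + 1 ≥ 1` distinct vertices
`v 0, …, v n` and distinct edges `e 0, …, e n` such that `e i` joins `v i` to `v (i + 1)`
(indices are cyclic, `n + 1 = 0` in `Fin (n + 1)`), and `C = {e 0, …, e n}`.
A loop is a cycle with one edge, two parallel edges form a cycle with two edges. -/
def IsCycle (G : Graph V β) (C : Set β) : Prop :=
  ∃ (n : ℕ) (v : Fin (n + 1) → V) (e : Fin (n + 1) → β),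
    Function.Injective v ∧ Function.Injective e ∧
      (∀ i, G.IsLink (e i) (v i) (v (i + 1))) ∧ Set.range e = C

/-- `I` is a set of edges of `G` that contains no cycle. -/
def IsAcyclicSet (G : Graph V β) (I : Set β) : Prop :=
  I ⊆ G.edgeSet ∧ ∀ C, G.IsCycle C → ¬ C ⊆ I

/-- The minimum cycle length of `G` is `l` (in particular `G` has a cycle). -/
def HasMinCycleLength (G : Graph V β) (l : ℕ) : Prop :=
  IsLeast {k : ℕ | ∃ C, G.IsCycle C ∧ C.ncard = k} l

/-! Auxiliary facts: the acyclic edge sets satisfy the matroid axioms. -/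

/-- Two vertices are joined by a walk all of whose edges are in `I`. -/
def JoinedIn (G : Graph V β) (I : Set β) : V → V → Prop :=
  Relation.ReflTransGen (fun x y => ∃ e ∈ I, G.IsLink e x y)

theorem JoinedIn.symm {I : Set β} {x y : V} (h : G.JoinedIn I x y) : G.JoinedIn I y x := by
  unfold JoinedIn at *
  induction h with
  | refl => exact .refl
  | tail _ hbc ih =>
    obtain ⟨e, he, hl⟩ := hbc
    exact Relation.ReflTransGen.head ⟨e, he, hl.symm⟩ ih

theorem IsAcyclicSet.mono {I J : Set β} (hJ : G.IsAcyclicSet J) (h : I ⊆ J) :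
    G.IsAcyclicSet I :=
  ⟨h.trans hJ.1, fun C hC hCI => hJ.2 C hC (hCI.trans h)⟩

theorem JoinedIn.exists_walk [hβ : Nonempty β] {I : Set β} {x y : V} (h : G.JoinedIn I x y) :
    ∃ (n : ℕ) (v : ℕ → V) (f : ℕ → β), v 0 = x ∧ v n = y ∧
      ∀ i < n, f i ∈ I ∧ G.IsLink (f i) (v i) (v (i + 1)) := by
  unfold JoinedIn at h
  induction h with
  | refl =>
    exact ⟨0, fun _ => x, fun _ => hβ.some, rfl, rfl, by simp⟩
  | @tail b c _ hbc ih =>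
    obtain ⟨n, v, f, h0, hn, hs⟩ := ih
    obtain ⟨e, he, hl⟩ := hbc
    refine ⟨n + 1, fun i => if i ≤ n then v i else c, fun i => if i < n then f i else e,
      by simpa using h0, by simp, ?_⟩
    intro i hi
    by_cases hin : i < n
    · simpa [hin, hin.le, Nat.succ_le_of_lt hin] using hs i hin
    · obtain rfl : i = n := by omega
      simpa [hn] using ⟨he, hl⟩

theorem JoinedIn.exists_cycle {I : Set β} {x y : V} {e : β} (h : G.JoinedIn I x y)
    (he : e ∉ I) (hl : G.IsLink e x y) : ∃ C ⊆ insert e I, G.IsCycle C := by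
  classical
  have : Nonempty β := ⟨e⟩
  have hex := h.exists_walk
  obtain ⟨v, f, h0, hn, hs⟩ := Nat.find_spec hex
  set n := Nat.find hex with hn_def
  have hmin : ∀ k < n, ¬ ∃ (v : ℕ → V) (f : ℕ → β), v 0 = x ∧ v k = y ∧
      ∀ i < k, f i ∈ I ∧ G.IsLink (f i) (v i) (v (i + 1)) := fun k hk => Nat.find_min hex hk
  have hv : ∀ i j, i < j → j ≤ n → v i ≠ v j := by
    intro i j hij hj heq
    refine hmin (n - (j - i)) (by omega)
      ⟨fun t => if t ≤ i then v t else v (t + (j - i)),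
        fun t => if t < i then f t else f (t + (j - i)), by simpa using h0, ?_, ?_⟩
    · by_cases hjn : n - (j - i) ≤ i
      · have h1 : n - (j - i) = i := by omega
        have h2 : j = n := by omega
        simp only [h1, le_refl, if_true]
        rw [heq, h2, hn]
      · simp only [hjn, if_false]
        rw [show n - (j - i) + (j - i) = n by omega, hn]
    · intro t ht
      by_cases hti : t < i
      · simpa [hti, hti.le, Nat.succ_le_of_lt hti] using hs t (by omega)
      · have h3 := hs (t + (j - i)) (by omega)
        by_cases hti' : t = i
        · subst hti'
          simp only [lt_irrefl, if_false, le_refl, if_true, show ¬ (t + 1 ≤ t) by omega]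
          rw [heq]
          rw [show t + (j - t) = j by omega] at h3 ⊢
          rw [show t + 1 + (j - t) = j + 1 by omega]
          exact h3
        · simp only [hti, if_false, show ¬ (t ≤ i) by omega, show ¬ (t + 1 ≤ i) by omega]
          rw [show t + 1 + (j - i) = t + (j - i) + 1 by omega]
          exact h3
  have hvinj : ∀ i j, i ≤ n → j ≤ n → v i = v j → i = j := by
    intro i j hi hj hij
    rcases lt_trichotomy i j with h | h | h
    · exact (hv i j h hj hij).elim
    · exact h
    · exact (hv j i h hi hij.symm).elim
  have hfinj : ∀ i j, i < n → j < n → f i = f j → i = j := by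
    intro i j hi hj hij
    have h1 := (hs i hi).2
    have h2 := (hs j hj).2
    rw [hij] at h1
    rcases h1.eq_and_eq_or_eq_and_eq h2 with ⟨ha, _⟩ | ⟨ha, hb⟩
    · exact hvinj _ _ (by omega) (by omega) ha
    · have := hvinj _ _ (by omega) (by omega) ha
      have := hvinj _ _ (by omega) (by omega) hb
      omega
  refine ⟨Set.range (fun i : Fin (n + 1) => if (i : ℕ) < n then f i else e), ?_, n,
    fun i => v i, fun i => if (i : ℕ) < n then f i else e, ?_, ?_, ?_, rfl⟩
  · rintro _ ⟨i, rfl⟩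
    by_cases hi : (i : ℕ) < n
    · simpa [hi] using Or.inr (hs i hi).1
    · simp [hi]
  · intro i j hij
    exact Fin.ext (hvinj _ _ (by omega) (by omega) hij)
  · intro i j hij
    apply Fin.ext
    by_cases hi : (i : ℕ) < n <;> by_cases hj : (j : ℕ) < n
    · simp only [hi, hj, if_true] at hij
      exact hfinj _ _ hi hj hij
    · simp only [hi, hj, if_true, if_false] at hij
      exact (he (hij ▸ (hs i hi).1)).elim
    · simp only [hi, hj, if_true, if_false] at hij
      exact (he (hij ▸ (hs j hj).1)).elim
    · omega
  · intro i
    by_cases hi : (i : ℕ) < n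
    · have h1 : ((i + 1 : Fin (n + 1)) : ℕ) = i + 1 := by
        rw [Fin.val_add_one_of_lt]
        exact Fin.lt_def.2 (by simpa using hi)
      simpa [hi, h1] using (hs i hi).2
    · obtain rfl : i = Fin.last n := Fin.ext (by simp; omega)
      simpa [h0, hn] using hl.symm

theorem IsAcyclicSet.insert_of_not_joinedIn {I : Set β} {x y : V} {e : β} (hI : G.IsAcyclicSet I)
    (hl : G.IsLink e x y) (hxy : ¬ G.JoinedIn I x y) : G.IsAcyclicSet (insert e I) := by
  refine ⟨Set.insert_subset hl.edge_mem hI.1, ?_⟩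
  intro C hC hCI
  obtain ⟨n, v, f, hv, hf, hlink, rfl⟩ := hC
  have hmem : ∃ k, f k = e := by
    by_contra hne
    push Not at hne
    refine hI.2 _ ⟨n, v, f, hv, hf, hlink, rfl⟩ ?_
    rintro _ ⟨i, rfl⟩
    exact (hCI ⟨i, rfl⟩).resolve_left (hne i)
  obtain ⟨k, hk⟩ := hmem
  have hval : ∀ t : ℕ, t ≤ n → ((t • (1 : Fin (n + 1)) : Fin (n + 1)) : ℕ) = t := by
    intro t
    induction t with
    | zero => intro _; simp
    | succ t ih =>
      intro ht
      have h1 := ih (by omega)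
      rw [succ_nsmul, Fin.val_add_one_of_lt, h1]
      rw [Fin.lt_def, h1, Fin.val_last]
      omega
  have hwalk : ∀ t : ℕ, t ≤ n →
      G.JoinedIn I (v (k + 1)) (v (k + 1 + t • (1 : Fin (n + 1)))) := by
    intro t
    induction t with
    | zero =>
      intro _
      rw [zero_nsmul, add_zero]
      exact Relation.ReflTransGen.refl
    | succ t ih =>
      intro ht
      refine Relation.ReflTransGen.tail (ih (by omega))
        ⟨f (k + 1 + t • (1 : Fin (n + 1))), ?_, ?_⟩
      · refine (hCI ⟨_, rfl⟩).resolve_left fun h => ?_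
        have h1 := hf (h.trans hk.symm)
        rw [add_assoc, ← succ_nsmul', add_eq_left] at h1
        have h2 := hval (t + 1) ht
        rw [h1] at h2
        simp at h2
      · have h1 := hlink (k + 1 + t • (1 : Fin (n + 1)))
        rwa [add_assoc (k + 1), ← succ_nsmul] at h1
  have hfin := hwalk n le_rfl
  have hround : k + 1 + n • (1 : Fin (n + 1)) = k := by
    have h1 : (n + 1) • (1 : Fin (n + 1)) = 0 := by
      simpa using card_nsmul_eq_zero' (G := Fin (n + 1)) (x := 1)
    rw [add_assoc, ← succ_nsmul', h1, add_zero]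
  rw [hround] at hfin
  have hlk := hlink k
  rw [hk] at hlk
  rcases hl.eq_and_eq_or_eq_and_eq hlk with ⟨rfl, rfl⟩ | ⟨rfl, rfl⟩
  · exact hxy hfin.symm
  · exact hxy hfin

open Classical in
/-- The signed incidence vector of an edge, for some choice of orientation. -/
noncomputable def incVec (G : Graph V β) (e : β) : V →₀ ℚ :=
  if h : ∃ p : V × V, G.IsLink e p.1 p.2 then
    Finsupp.single h.choose.1 1 - Finsupp.single h.choose.2 1 else 0

theorem incVec_eq {e : β} {x y : V} (h : G.IsLink e x y) :
    G.incVec e = Finsupp.single x 1 - Finsupp.single y 1 ∨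
      G.incVec e = -(Finsupp.single x 1 - Finsupp.single y 1) := by
  have hex : ∃ p : V × V, G.IsLink e p.1 p.2 := ⟨(x, y), h⟩
  rw [incVec, dif_pos hex]
  rcases hex.choose_spec.eq_and_eq_or_eq_and_eq h with ⟨h1, h2⟩ | ⟨h1, h2⟩
  · left; rw [h1, h2]
  · right; rw [h1, h2]; abel

theorem JoinedIn.sub_mem_span {I : Set β} {x y : V} (h : G.JoinedIn I x y) :
    (Finsupp.single x 1 - Finsupp.single y 1 : V →₀ ℚ) ∈ Submodule.span ℚ (G.incVec '' I) := by
  unfold JoinedIn at h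
  induction h with
  | refl => simp
  | @tail b c _ hbc ih =>
    obtain ⟨e, he, hl⟩ := hbc
    have hm : G.incVec e ∈ Submodule.span ℚ (G.incVec '' I) :=
      Submodule.subset_span ⟨e, he, rfl⟩
    have hbc : (Finsupp.single b 1 - Finsupp.single c 1 : V →₀ ℚ) ∈
        Submodule.span ℚ (G.incVec '' I) := by
      rcases incVec_eq hl with h | h
      · rwa [← h]
      · rw [h] at hm; exact (Submodule.neg_mem_iff _).1 hm
    have := Submodule.add_mem _ ih hbc
    simpa using this

theorem IsAcyclicSet.linearIndepOn [Finite β] {I : Set β} (hI : G.IsAcyclicSet I) :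
    LinearIndepOn ℚ G.incVec I := by
  classical
  induction I, Set.toFinite I using Set.Finite.induction_on with
  | empty => exact linearIndepOn_empty _ _
  | @insert e I heI _ ih =>
    have hI' := hI.mono (Set.subset_insert e I)
    refine (ih hI').insert ?_
    obtain ⟨x, y, hl⟩ := exists_isLink_of_mem_edgeSet (hI.1 (Set.mem_insert e I))
    have hxy : ¬ G.JoinedIn I x y := fun h => by
      obtain ⟨C, hC, hC'⟩ := h.exists_cycle heI hl
      exact hI.2 C hC' hC
    let φ : (V →₀ ℚ) →ₗ[ℚ] ℚ :=
      Finsupp.linearCombination ℚ (fun z => if G.JoinedIn I x z then (1 : ℚ) else 0)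
    have hφ : ∀ z, φ (Finsupp.single z 1) = if G.JoinedIn I x z then (1 : ℚ) else 0 := by
      intro z; simp [φ]
    intro hmem
    have hker : Submodule.span ℚ (G.incVec '' I) ≤ LinearMap.ker φ := by
      rw [Submodule.span_le]
      rintro _ ⟨f, hf, rfl⟩
      obtain ⟨a, b, hab⟩ := exists_isLink_of_mem_edgeSet (hI'.1 hf)
      have hiff : G.JoinedIn I x a ↔ G.JoinedIn I x b :=
        ⟨fun h => Relation.ReflTransGen.tail h ⟨f, hf, hab⟩,
          fun h => Relation.ReflTransGen.tail h ⟨f, hf, hab.symm⟩⟩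
      rcases incVec_eq hab with h | h <;>
        simp [LinearMap.mem_ker, h, hφ, hiff]
    have h0 := LinearMap.mem_ker.1 (hker hmem)
    have hxx : G.JoinedIn I x x := Relation.ReflTransGen.refl
    rcases incVec_eq hl with h | h <;> simp [h, hφ, hxx, hxy] at h0

theorem IsAcyclicSet.exists_insert [Finite β] {I J : Set β} (hI : G.IsAcyclicSet I)
    (hJ : G.IsAcyclicSet J) (hIJ : I.ncard < J.ncard) :
    ∃ e ∈ J, e ∉ I ∧ G.IsAcyclicSet (insert e I) := by
  classical
  by_contra hcon
  push Not at hcon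
  have hspan : ∀ e ∈ J, G.incVec e ∈ Submodule.span ℚ (G.incVec '' I) := by
    intro e he
    by_cases heI : e ∈ I
    · exact Submodule.subset_span ⟨e, heI, rfl⟩
    obtain ⟨x, y, hl⟩ := exists_isLink_of_mem_edgeSet (hJ.1 he)
    have hxy : G.JoinedIn I x y := by
      by_contra hxy
      exact hcon e he heI (hI.insert_of_not_joinedIn hl hxy)
    have := hxy.sub_mem_span
    rcases incVec_eq hl with h | h
    · rwa [h]
    · rw [h]; exact Submodule.neg_mem _ this
  have hfin : (G.incVec '' I).Finite := (Set.toFinite I).image _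
  have : Fintype (G.incVec '' I) := hfin.fintype
  have : Fintype J := (Set.toFinite J).fintype
  have hle := linearIndependent_le_span_aux' (R := ℚ) (fun e : J => G.incVec e)
    hJ.linearIndepOn (G.incVec '' I) (by rintro _ ⟨e, rfl⟩; exact hspan e e.2)
  have h1 : Fintype.card J = J.ncard := by
    rw [← Nat.card_eq_fintype_card, Nat.card_coe_set_eq]
  have h2 : Fintype.card (G.incVec '' I) ≤ I.ncard := by
    rw [← Nat.card_eq_fintype_card, Nat.card_coe_set_eq]
    exact Set.ncard_image_le (Set.toFinite I)
  omega

/-- The graphic matroid (cycle matroid) of a multigraph `G` with finitely many edges: the ground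
set is the edge set of `G`, and a set of edges is independent if it contains no cycle of `G`.
Its bases are the spanning forests of `G`. -/
def cycleMatroid [Finite β] (G : Graph V β) : Matroid β :=
  (IndepMatroid.ofFinite (E := G.edgeSet) (Set.toFinite _) G.IsAcyclicSet
    ⟨Set.empty_subset _, by
      rintro C ⟨n, v, e, -, -, -, rfl⟩ h
      exact h ⟨0, rfl⟩⟩
    (fun _ _ hJ h => IsAcyclicSet.mono hJ h)
    (fun _ _ hI hJ h => IsAcyclicSet.exists_insert hI hJ h)
    (fun _ hI => hI.1)).matroid

end Graph

/-- A deterministic parallel decision tree on the ground set `Fin m`. At an inner node the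
algorithm submits, in one round, the sets `Q 0, …, Q (q - 1)` to the oracle; these do not depend on
the answers given in that round. The answers decide the branch on which it goes on. At a leaf it
stops and outputs a set. -/
inductive ParallelTree (m : ℕ) : Type
  | output (F : Finset (Fin m)) : ParallelTree m
  | round (q : ℕ) (Q : Fin q → Finset (Fin m)) (next : (Fin q → Bool) → ParallelTree m) :
      ParallelTree m

namespace ParallelTree

variable {m : ℕ}

/-- The set that the algorithm outputs when the oracle is `f`. -/
def run (f : Finset (Fin m) → Bool) : ParallelTree m → Finset (Fin m)
  | output F => F
  | round _ Q next => run f (next fun i => f (Q i))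

/-- The number of adaptive rounds in the worst case. -/
def rounds : ParallelTree m → ℕ
  | output _ => 0
  | round _ _ next => (Finset.univ.sup fun a => rounds (next a)) + 1

/-- The largest number of queries that are made in a single round. -/
def queriesPerRound : ParallelTree m → ℕ
  | output _ => 0
  | round q _ next => max q (Finset.univ.sup fun a => queriesPerRound (next a))

/-- Every set that is ever submitted to the oracle satisfies `P`. -/
def AllQueries (P : Finset (Fin m) → Prop) : ParallelTree m → Prop
  | output _ => True
  | round _ Q next => (∀ i, P (Q i)) ∧ ∀ a, AllQueries P (next a)

end ParallelTree

open Classical in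
/-- The independence oracle of a matroid on `Fin m`. -/
noncomputable def indepOracle {m : ℕ} (M : Matroid (Fin m)) (S : Finset (Fin m)) : Bool :=
  decide (M.Indep (S : Set (Fin m)))

/-- One family of query sets `B j l`, consisting of subsets of `{0, …, j - 1}`, for each edge
count `j` and each minimum cycle length `l`. -/
abbrev QueryFamilies : Type :=
  (j l : ℕ) → Finset (Finset (Fin j))

/-- For all `j` and `l`, the family `B j l` is universal: in every graph with edge set
`{0, …, j - 1}` and minimum cycle length `l`, every cycle `C` of length in `[l, 1.01 l]` is the
only cycle that is contained in some member of `B j l`. -/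
def QueryFamilies.IsUniversal (B : QueryFamilies) : Prop :=
  ∀ (j l : ℕ) (V : Type u) (G : Graph V (Fin j)), G.edgeSet = Set.univ → G.HasMinCycleLength l →
    ∀ C, G.IsCycle C → (l : ℝ) ≤ C.ncard → (C.ncard : ℝ) ≤ 1.01 * l →
      ∃ S ∈ B j l, ∀ C', G.IsCycle C' ∧ C' ⊆ (S : Set (Fin j)) ↔ C' = C

/-- The family `B j l` has at most `s j` members. -/
def QueryFamilies.HasSize (B : QueryFamilies) (s : Polynomial ℕ) : Prop :=
  ∀ j l, (B j l).card ≤ s.eval j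

/-- The queries that an algorithm on `m` edges may draw from `B`: for some set `E` of edges (the
edges that are still present) and some `l ∈ [m]`, a member `S` of `B |E| l`, carried over to `E` by
the increasing bijection from `{0, …, |E| - 1}` to `E`, from which at most one edge has
been removed. -/
def QueryFamilies.Provides (B : QueryFamilies) {m : ℕ} (Q : Finset (Fin m)) : Prop :=
  ∃ (E : Finset (Fin m)) (l : ℕ) (S : Finset (Fin E.card)) (D : Finset (Fin m)),
    1 ≤ l ∧ l ≤ m ∧ S ∈ B E.card l ∧ D.card ≤ 1 ∧
      Q = S.map (E.orderEmbOfFin rfl).toEmbedding \ D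

/-! Universal families come from random sampling. Let `C` be a cycle of length at most `1.01 l`, put
`k = (l - 1) / 5`, and choose each of the `j` edges with probability `p`, where `p ^ (k + 1) = (8 j)
^ (-2)`. Then `C` survives with probability at least `(8 j) ^ (-12)`. Another cycle `C'` costs the
further factor `p ^ |C' \ C|`. Contracting `C` leaves girth above `2 k`
(`HasMinCycleLength.girthModGT`), so walks of length at most `k` are determined modulo 2 by their
ends, and a closed walk is encoded by every `(k + 1)`-st oriented edge. At most `(2 j) ^ n` sets `C'
\ C` therefore need `n` marks (`GirthModGT.card_le`), each of weight at most `(8 j) ^ (-n)`. The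
geometric sum is at most `1/2`, so `C` is isolated with inverse polynomial probability.

Isolation depends only on the cycle space over `ZMod 2`, so there are at most `2 ^ (j * j + j)`
pairs of a cycle space and a cycle to serve. Greedy averaging (`exists_finset_hitting`) finds
polynomially many sets that serve all of them.

The algorithm queries every carried member of the families, whole and with one edge removed. It
deletes the largest edge of each isolated cycle, all at once. A deleted edge is spanned by smaller
edges, so the span is kept (`closure_prune`). Every cycle within a factor `1.01` of the current
length bound loses an edge, so the bound grows by that factor in each round (`iterate_prune`) and
exceeds `m` after `O(log m)` rounds. -/

/-! ### Even edge sets: the cycle space modulo 2 -/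

theorem Finset.sum_symmDiff_of_char_two {ι W : Type*} [DecidableEq ι] [AddCommGroup W]
    [Module (ZMod 2) W] (f : ι → W) (S T : Finset ι) :
    ∑ i ∈ symmDiff S T, f i = ∑ i ∈ S, f i + ∑ i ∈ T, f i := by
  have h1 := Finset.sum_inter_add_sum_sdiff S T f
  have h2 := Finset.sum_inter_add_sum_sdiff T S f
  have h3 : ∑ i ∈ symmDiff S T, f i = ∑ i ∈ S \ T, f i + ∑ i ∈ T \ S, f i :=
    Finset.sum_union disjoint_sdiff_sdiff
  rw [h3, ← h1, ← h2, Finset.inter_comm T S]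
  have h4 := ZModModule.add_self (∑ i ∈ S ∩ T, f i)
  calc _ = (∑ i ∈ S ∩ T, f i + ∑ i ∈ S ∩ T, f i) + (∑ i ∈ S \ T, f i + ∑ i ∈ T \ S, f i) := by
        rw [h4, zero_add]
    _ = _ := by abel

namespace Graph

variable {V β : Type*} {G : Graph V β}

open Classical in
/-- The incidence vector modulo 2 of an edge; it vanishes for loops. -/
noncomputable def bd (G : Graph V β) (e : β) : V →₀ ZMod 2 :=
  if h : ∃ p : V × V, G.IsLink e p.1 p.2 then
    Finsupp.single h.choose.1 1 + Finsupp.single h.choose.2 1 else 0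

theorem IsLink.bd_eq {e : β} {x y : V} (h : G.IsLink e x y) :
    G.bd e = Finsupp.single x 1 + Finsupp.single y 1 := by
  have hex : ∃ p : V × V, G.IsLink e p.1 p.2 := ⟨(x, y), h⟩
  rw [bd, dif_pos hex]
  rcases hex.choose_spec.eq_and_eq_or_eq_and_eq h with ⟨h1, h2⟩ | ⟨h1, h2⟩
  · rw [h1, h2]
  · rw [h1, h2, add_comm]

/-- The set `D` of edges meets every vertex an even number of times. -/
def IsEven (G : Graph V β) (D : Finset β) : Prop := ∑ e ∈ D, G.bd e = 0

theorem IsEven.symmDiff [DecidableEq β] {S T : Finset β} (hS : G.IsEven S) (hT : G.IsEven T) :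
    G.IsEven (symmDiff S T) := by
  unfold IsEven at *
  rw [Finset.sum_symmDiff_of_char_two, hS, hT, add_zero]

theorem IsCycle.isEven {D : Finset β} (h : G.IsCycle (D : Set β)) : G.IsEven D := by
  classical
  obtain ⟨n, v, e, -, he, hl, hr⟩ := h
  have hD : D = Finset.univ.image e := by
    apply Finset.coe_injective
    rw [← hr]; simp
  rw [IsEven, hD, Finset.sum_image fun a _ b _ h => he h]
  simp_rw [fun i => (hl i).bd_eq]
  have hshift := Equiv.sum_comp (Equiv.addRight (1 : Fin (n + 1)))
    (fun i => Finsupp.single (v i) (1 : ZMod 2))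
  simp only [Equiv.coe_addRight] at hshift
  rw [Finset.sum_add_distrib, hshift, ZModModule.add_self]

theorem IsCycle.nonempty {C : Set β} (h : G.IsCycle C) : C.Nonempty := by
  obtain ⟨n, v, e, -, -, -, rfl⟩ := h
  exact ⟨e 0, 0, rfl⟩

/-- Take an edge `e` of `D`. If the rest of `D` joins its ends, a cycle closes. Otherwise the
indicator of the component of one end vanishes on the boundary of every other edge of `D` but not on
that of `e`, so the boundaries cannot sum to zero. -/
theorem IsEven.exists_isCycle {D : Finset β} (h : G.IsEven D) (hD : D.Nonempty)
    (hE : (D : Set β) ⊆ G.edgeSet) : ∃ C : Finset β, C ⊆ D ∧ G.IsCycle (C : Set β) := by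
  classical
  obtain ⟨e, he⟩ := hD
  suffices ∃ C, C ⊆ (D : Set β) ∧ G.IsCycle C by
    obtain ⟨C, hC, hc⟩ := this
    have hf := D.finite_toSet.subset hC
    exact ⟨hf.toFinset, by simpa using hC, by simpa using hc⟩
  obtain ⟨x, y, hl⟩ := exists_isLink_of_mem_edgeSet (hE he)
  by_cases hxy : G.JoinedIn (D \ {e} : Set β) x y
  · obtain ⟨C, hC, hc⟩ := hxy.exists_cycle (by simp) hl
    exact ⟨C, hC.trans (by simp [he]), hc⟩
  exfalso
  let I : Set β := D \ {e}
  let φ : (V →₀ ZMod 2) →ₗ[ZMod 2] ZMod 2 :=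
    Finsupp.linearCombination (ZMod 2) (fun z => if G.JoinedIn I x z then (1 : ZMod 2) else 0)
  have hφ : ∀ z, φ (Finsupp.single z 1) = if G.JoinedIn I x z then (1 : ZMod 2) else 0 := by
    intro z; simp [φ]
  have h0 : φ (∑ f ∈ D, G.bd f) = 0 := by rw [h]; simp
  rw [map_sum, ← Finset.add_sum_erase _ _ he, Finset.sum_eq_zero, add_zero, hl.bd_eq, map_add,
    hφ, hφ, if_pos (show G.JoinedIn I x x from Relation.ReflTransGen.refl), if_neg hxy] at h0
  · simp at h0
  · intro f hf
    rw [Finset.mem_erase] at hf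
    obtain ⟨a, b, hab⟩ := exists_isLink_of_mem_edgeSet (hE hf.2)
    have hfI : f ∈ I := ⟨hf.2, hf.1⟩
    have hiff : G.JoinedIn I x a ↔ G.JoinedIn I x b :=
      ⟨fun h => Relation.ReflTransGen.tail h ⟨f, hfI, hab⟩,
        fun h => Relation.ReflTransGen.tail h ⟨f, hfI, hab.symm⟩⟩
    rw [hab.bd_eq, map_add, hφ, hφ, hiff, ZModModule.add_self]

theorem IsEven.le_card {D : Finset β} {l : ℕ} (hl : G.HasMinCycleLength l) (h : G.IsEven D)
    (hD : D.Nonempty) (hE : (D : Set β) ⊆ G.edgeSet) : l ≤ D.card := by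
  obtain ⟨C, hCD, hC⟩ := h.exists_isCycle hD hE
  refine (hl.2 ⟨C, hC, rfl⟩).trans ?_
  rw [Set.ncard_coe_finset]
  exact Finset.card_le_card hCD

end Graph

/-! ### Walks after contracting a cycle, and their encoding -/

namespace Graph

variable {V β : Type*} {G : Graph V β}

/-- The vertices `x` and `y` are identified when the edges in `C` are contracted. -/
def Congr (G : Graph V β) (C : Finset β) (x y : V) : Prop :=
  ∃ A ⊆ C, ∑ e ∈ A, G.bd e = Finsupp.single x 1 + Finsupp.single y 1

theorem Congr.refl (C : Finset β) (x : V) : G.Congr C x x :=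
  ⟨∅, Finset.empty_subset _, by rw [Finset.sum_empty, ZModModule.add_self]⟩

theorem _root_.Finset.symmDiff_subset_of_subset {ι : Type*} [DecidableEq ι] {S T U : Finset ι}
    (hS : S ⊆ U) (hT : T ⊆ U) : symmDiff S T ⊆ U :=
  symmDiff_le_sup.trans (sup_le hS hT)

theorem _root_.Finset.card_symmDiff_le_add {ι : Type*} [DecidableEq ι] (S T : Finset ι) :
    (symmDiff S T).card ≤ S.card + T.card :=
  (Finset.card_le_card symmDiff_le_sup).trans (Finset.card_union_le S T)

theorem _root_.ZModModule.add_add_add_cancel_middle {W : Type*} [AddCommGroup W]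
    [Module (ZMod 2) W] (x y z : W) : (x + y) + (y + z) = x + z := by
  rw [show (x + y) + (y + z) = x + z + (y + y) by abel, ZModModule.add_self, add_zero]

section

variable [DecidableEq β]

theorem Congr.trans {C : Finset β} {x y z : V} (h : G.Congr C x y) (h' : G.Congr C y z) :
    G.Congr C x z := by
  obtain ⟨A, hA, hs⟩ := h
  obtain ⟨A', hA', hs'⟩ := h'
  refine ⟨symmDiff A A', Finset.symmDiff_subset_of_subset hA hA', ?_⟩
  rw [Finset.sum_symmDiff_of_char_two, hs, hs', ZModModule.add_add_add_cancel_middle]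

/-- The list `l` of oriented edges, an oriented edge `d` going from `s d` to `t d`, is a walk
from `x` to `y` in the graph in which the edges in `C` are contracted. -/
def IsWalkMod (G : Graph V β) (C : Finset β) (s t : β × Bool → V) :
    V → List (β × Bool) → V → Prop
  | x, [], y => G.Congr C x y
  | x, d :: l, y => G.Congr C x (s d) ∧ IsWalkMod G C s t (t d) l y

/-- The edges that occur an odd number of times in a list of oriented edges. -/
def oddEdges : List (β × Bool) → Finset β
  | [] => ∅
  | d :: l => symmDiff {d.1} (oddEdges l)

theorem card_oddEdges_le (l : List (β × Bool)) : (oddEdges l).card ≤ l.length := by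
  induction l with
  | nil => simp [oddEdges]
  | cons d l ih =>
    refine (Finset.card_symmDiff_le_add _ _).trans ?_
    simp; omega

theorem oddEdges_subset {l : List (β × Bool)} {U : Finset β} (h : ∀ d ∈ l, d.1 ∈ U) :
    oddEdges l ⊆ U := by
  induction l with
  | nil => simp [oddEdges]
  | cons d l ih =>
    refine Finset.symmDiff_subset_of_subset ?_ (ih fun d hd => h d (List.mem_cons_of_mem _ hd))
    simpa using h d List.mem_cons_self

theorem disjoint_oddEdges {l : List (β × Bool)} {U : Finset β} (h : ∀ d ∈ l, d.1 ∉ U) :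
    Disjoint (oddEdges l) U := by
  have h1 : oddEdges l ⊆ (l.map Prod.fst).toFinset :=
    oddEdges_subset fun d hd =>
      List.mem_toFinset.2 (List.mem_map_of_mem hd)
  refine Finset.disjoint_left.2 fun e he heU => ?_
  have h2 := h1 he
  rw [List.mem_toFinset, List.mem_map] at h2
  obtain ⟨d, hd, rfl⟩ := h2
  exact h d hd heU

theorem oddEdges_append (l l' : List (β × Bool)) :
    oddEdges (l ++ l') = symmDiff (oddEdges l) (oddEdges l') := by
  induction l with
  | nil => exact (bot_symmDiff _).symm
  | cons d l ih => rw [List.cons_append, oddEdges, ih, oddEdges, symmDiff_assoc]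

theorem oddEdges_of_nodup {l : List (β × Bool)} (h : (l.map Prod.fst).Nodup) :
    oddEdges l = (l.map Prod.fst).toFinset := by
  induction l with
  | nil => simp [oddEdges]
  | cons d l ih =>
    rw [List.map_cons, List.nodup_cons] at h
    rw [oddEdges, ih h.2, List.map_cons, List.toFinset_cons, Finset.insert_eq]
    refine (Disjoint.symmDiff_eq_sup ?_)
    rw [Finset.disjoint_singleton_left, List.mem_toFinset]
    exact h.1

variable {C : Finset β} {s t : β × Bool → V}

theorem IsWalkMod.congr_left {x x' y : V} {l : List (β × Bool)} (hx : G.Congr C x' x)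
    (h : G.IsWalkMod C s t x l y) : G.IsWalkMod C s t x' l y := by
  cases l with
  | nil => exact hx.trans h
  | cons d l => exact ⟨hx.trans h.1, h.2⟩

theorem IsWalkMod.congr_right {x y y' : V} {l : List (β × Bool)} (hy : G.Congr C y y')
    (h : G.IsWalkMod C s t x l y) : G.IsWalkMod C s t x l y' := by
  induction l generalizing x with
  | nil => exact Congr.trans h hy
  | cons d l ih => exact ⟨h.1, ih h.2⟩

theorem IsWalkMod.append {x y z : V} {l l' : List (β × Bool)} (h : G.IsWalkMod C s t x l y)
    (h' : G.IsWalkMod C s t y l' z) : G.IsWalkMod C s t x (l ++ l') z := by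
  induction l generalizing x with
  | nil => exact h'.congr_left h
  | cons d l ih => exact ⟨h.1, ih h.2⟩

/-- The source of the first oriented edge of a list, with default value `y`. -/
def headSource (s : β × Bool → V) (l : List (β × Bool)) (y : V) : V :=
  l.head?.elim y s

omit [DecidableEq β] in
theorem IsWalkMod.of_append {x y : V} {l l' : List (β × Bool)}
    (h : G.IsWalkMod C s t x (l ++ l') y) :
    G.IsWalkMod C s t x l (headSource s l' y) ∧
      G.IsWalkMod C s t (headSource s l' y) l' y := by
  induction l generalizing x with
  | nil =>
    cases l' with
    | nil => exact ⟨h, Congr.refl _ _⟩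
    | cons d l' => exact ⟨h.1, Congr.refl _ _, h.2⟩
  | cons d l ih => exact ⟨⟨h.1, (ih h.2).1⟩, (ih h.2).2⟩

/-- The ends of an edge of `C` are identified by the contraction, so the edge can be skipped. -/
theorem IsWalkMod.filter (hst : ∀ d, G.IsLink d.1 (s d) (t d)) {x y : V} {l : List (β × Bool)}
    (h : G.IsWalkMod C s t x l y) :
    G.IsWalkMod C s t x (l.filter fun d => d.1 ∉ C) y := by
  induction l generalizing x with
  | nil => exact h
  | cons d l ih =>
    by_cases hd : d.1 ∈ C
    · rw [List.filter_cons_of_neg (by simpa using hd)]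
      refine (ih h.2).congr_left (h.1.trans ⟨{d.1}, by simpa using hd, ?_⟩)
      rw [Finset.sum_singleton, (hst d).bd_eq]
    · rw [List.filter_cons_of_pos (by simpa using hd)]
      exact ⟨h.1, ih h.2⟩

/-- The boundary telescopes along the walk. Each jump between identified vertices contributes a
subset of `C`, and repeated edges cancel modulo 2. -/
theorem IsWalkMod.exists_sum_bd (hst : ∀ d, G.IsLink d.1 (s d) (t d)) {x y : V}
    {l : List (β × Bool)} (h : G.IsWalkMod C s t x l y) :
    ∃ A ⊆ C, ∑ e ∈ A, G.bd e + ∑ e ∈ oddEdges l, G.bd e =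
      Finsupp.single x 1 + Finsupp.single y 1 := by
  induction l generalizing x with
  | nil =>
    obtain ⟨A, hA, hs⟩ := h
    exact ⟨A, hA, by simpa [oddEdges] using hs⟩
  | cons d l ih =>
    obtain ⟨A, hA, hs⟩ := h.1
    obtain ⟨A', hA', hs'⟩ := ih h.2
    refine ⟨symmDiff A A', Finset.symmDiff_subset_of_subset hA hA', ?_⟩
    rw [oddEdges, Finset.sum_symmDiff_of_char_two, Finset.sum_symmDiff_of_char_two,
      Finset.sum_singleton, add_add_add_comm, hs', hs, (hst d).bd_eq,
      ZModModule.add_add_add_cancel_middle, ZModModule.add_add_add_cancel_middle]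

/-- Every nonempty set of edges that is even after contracting `C` has more than `n` edges. -/
def GirthModGT (G : Graph V β) (C : Finset β) (n : ℕ) : Prop :=
  ∀ A D : Finset β, A ⊆ C → Disjoint D C → D.Nonempty →
    ∑ e ∈ A, G.bd e = ∑ e ∈ D, G.bd e → n < D.card

/-- Together the two walks form a closed walk with at most `2 * k` edges. Its odd part is even after
contraction, hence empty by the girth bound. -/
theorem GirthModGT.oddEdges_eq {k : ℕ} (hg : G.GirthModGT C (2 * k))
    (hst : ∀ d, G.IsLink d.1 (s d) (t d)) {x y : V} {l l' : List (β × Bool)}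
    (h : G.IsWalkMod C s t x l y) (h' : G.IsWalkMod C s t x l' y) (hl : l.length ≤ k)
    (hl' : l'.length ≤ k) (hC : ∀ d ∈ l, d.1 ∉ C) (hC' : ∀ d ∈ l', d.1 ∉ C) :
    oddEdges l = oddEdges l' := by
  by_contra hne
  obtain ⟨A, hA, hs⟩ := h.exists_sum_bd hst
  obtain ⟨A', hA', hs'⟩ := h'.exists_sum_bd hst
  have h1 : Disjoint (symmDiff (oddEdges l) (oddEdges l')) C :=
    Disjoint.mono_left symmDiff_le_sup
      (Finset.disjoint_union_left.2 ⟨disjoint_oddEdges hC, disjoint_oddEdges hC'⟩)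
  have h2 : (symmDiff (oddEdges l) (oddEdges l')).Nonempty := by
    rw [Finset.nonempty_iff_ne_empty]
    exact fun h => hne (symmDiff_eq_bot.1 h)
  have h3 := hg (symmDiff A A') _ (Finset.symmDiff_subset_of_subset hA hA') h1 h2 (by
    rw [Finset.sum_symmDiff_of_char_two, Finset.sum_symmDiff_of_char_two]
    have h4 := hs.trans hs'.symm
    rw [← sub_eq_zero] at h4 ⊢
    rw [← h4]
    simp only [ZModModule.sub_eq_add]
    abel)
  have h4 := Finset.card_symmDiff_le_add (oddEdges l) (oddEdges l')
  have h5 := card_oddEdges_le l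
  have h6 := card_oddEdges_le l'
  omega

open Classical in
/-- The edge set of some walk of length at most `k` from `x` to `y` that avoids `C`. -/
noncomputable def segment (G : Graph V β) (C : Finset β) (s t : β × Bool → V) (k : ℕ) (x y : V) :
    Finset β :=
  if h : ∃ l, G.IsWalkMod C s t x l y ∧ l.length ≤ k ∧ ∀ d ∈ l, d.1 ∉ C then
    oddEdges h.choose else ∅

/-- Uniqueness of short walks makes the choice inside `segment` immaterial. -/
theorem GirthModGT.segment_eq {k : ℕ} (hg : G.GirthModGT C (2 * k))
    (hst : ∀ d, G.IsLink d.1 (s d) (t d)) {x y : V} {l : List (β × Bool)}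
    (h : G.IsWalkMod C s t x l y) (hl : l.length ≤ k) (hC : ∀ d ∈ l, d.1 ∉ C) :
    G.segment C s t k x y = oddEdges l := by
  have hex : ∃ l, G.IsWalkMod C s t x l y ∧ l.length ≤ k ∧ ∀ d ∈ l, d.1 ∉ C := ⟨l, h, hl, hC⟩
  rw [segment, dif_pos hex]
  obtain ⟨h1, h2, h3⟩ := hex.choose_spec
  exact hg.oddEdges_eq hst h1 h h2 hl h3 hC

/-- The edge set of the walk to `y` that runs through the oriented edges in `c` and bridges the
gaps between them by walks of length at most `k`. -/
noncomputable def decode (G : Graph V β) (C : Finset β) (s t : β × Bool → V) (k : ℕ) :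
    List (β × Bool) → V → Finset β
  | [], _ => ∅
  | d :: c, y =>
    symmDiff (symmDiff {d.1} (G.segment C s t k (t d) (headSource s c y))) (decode G C s t k c y)

/-- Mark the first edge and then every `(k + 1)`-st one; the at most `k` edges after each mark are
recovered by `segment`. The two inequalities say that `n` is the length divided by `k + 1`, rounded
up. -/
theorem GirthModGT.exists_decode_eq {k : ℕ} (hg : G.GirthModGT C (2 * k))
    (hst : ∀ d, G.IsLink d.1 (s d) (t d)) (n : ℕ) {x y : V} {l : List (β × Bool)}
    (h : G.IsWalkMod C s t x l y) (hC : ∀ d ∈ l, d.1 ∉ C) (hl : l.length ≤ n * (k + 1))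
    (hl' : n * (k + 1) < l.length + (k + 1)) :
    ∃ c : List (β × Bool), c.length = n ∧ c.head? = l.head? ∧
      G.decode C s t k c y = oddEdges l := by
  induction n generalizing x l with
  | zero =>
    obtain rfl : l = [] := by simpa using hl
    exact ⟨[], rfl, rfl, rfl⟩
  | succ n ih =>
    cases l with
    | nil => simp [add_mul] at hl'; omega
    | cons d l =>
      rw [List.length_cons] at hl hl'
      rw [add_mul, one_mul] at hl hl'
      have hw := h.2
      rw [← List.take_append_drop k l] at hw
      obtain ⟨h1, h2⟩ := hw.of_append
      have hCl : ∀ d ∈ l, d.1 ∉ C := fun d hd => hC d (List.mem_cons_of_mem _ hd)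
      -- A short remainder means that this mark is the last one; this controls the truncated
      -- subtraction in the length of `l.drop k`.
      have hn : l.length < k → n = 0 := by
        intro hlt
        rcases n with _ | n
        · rfl
        · rw [add_mul] at hl'; omega
      obtain ⟨c, hc, hc', hc''⟩ := ih h2 (fun d hd => hCl d (List.mem_of_mem_drop hd))
        (by rw [List.length_drop]; omega)
        (by
          rw [List.length_drop]
          by_cases hlt : l.length < k
          · rw [hn hlt]; omega
          · omega)
      refine ⟨d :: c, by simp [hc], rfl, ?_⟩
      have h3 : headSource s c y = headSource s (l.drop k) y := by
        rw [headSource, headSource, hc']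
      rw [decode, hc'', h3, hg.segment_eq hst h1 (List.length_take_le _ _)
        (fun d hd => hCl d (List.mem_of_mem_take hd)), symmDiff_assoc, ← oddEdges_append,
        List.take_append_drop, oddEdges]

/-- Up to contraction of `C`, the cycle `C'` is a closed walk. -/
theorem IsCycle.exists_isWalkMod {C' : Finset β} (h : G.IsCycle (C' : Set β))
    (hlink : ∀ e x y, G.IsLink e x y → ∃ b, s (e, b) = x ∧ t (e, b) = y) (C : Finset β) :
    ∃ x l, G.IsWalkMod C s t x l x ∧ (l.map Prod.fst).Nodup ∧ (l.map Prod.fst).toFinset = C' := by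
  obtain ⟨n, v, e, -, he, hl, hr⟩ := h
  have hsucc : ∀ k : ℕ, Fin.ofNat (n + 1) (k + 1) = Fin.ofNat (n + 1) k + 1 := by
    intro k
    apply Fin.ext
    simp [Fin.val_add]
  have key : ∀ k : ℕ, ∃ l, G.IsWalkMod C s t (v 0) l (v (Fin.ofNat (n + 1) k)) ∧
      l.map Prod.fst = (List.range k).map fun i => e (Fin.ofNat (n + 1) i) := by
    intro k
    induction k with
    | zero => exact ⟨[], Congr.refl _ _, rfl⟩
    | succ k ih =>
      obtain ⟨l, hw, hm⟩ := ih
      have h1 := hl (Fin.ofNat (n + 1) k)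
      obtain ⟨b, hb, hb'⟩ := hlink _ _ _ h1
      refine ⟨l ++ [(e (Fin.ofNat (n + 1) k), b)], hw.append ⟨?_, ?_⟩, ?_⟩
      · rw [hb]; exact Congr.refl _ _
      · rw [hb', hsucc]; exact Congr.refl _ _
      · rw [List.map_append, hm, List.range_succ, List.map_append]; rfl
  obtain ⟨l, hw, hm⟩ := key (n + 1)
  have h0 : Fin.ofNat (n + 1) (n + 1) = 0 := by apply Fin.ext; simp
  rw [h0] at hw
  refine ⟨v 0, l, hw, ?_, ?_⟩
  · rw [hm]
    refine List.Nodup.map_on ?_ List.nodup_range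
    intro a ha b hb hab
    have h1 := congrArg Fin.val (he hab)
    rw [List.mem_range] at ha hb
    simpa [Nat.mod_eq_of_lt ha, Nat.mod_eq_of_lt hb] using h1
  · apply Finset.coe_injective
    rw [← hr, hm]
    ext f
    simp only [List.coe_toFinset, List.mem_map, List.mem_range, Set.mem_ofPred_eq, Set.mem_range]
    constructor
    · rintro ⟨a, -, rfl⟩; exact ⟨_, rfl⟩
    · rintro ⟨i, rfl⟩
      exact ⟨i, i.2, by simp⟩

omit [DecidableEq β] in
theorem exists_source_target (hG : G.edgeSet = Set.univ) : ∃ s t : β × Bool → V,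
    (∀ d, G.IsLink d.1 (s d) (t d)) ∧
      ∀ e x y, G.IsLink e x y → ∃ b, s (e, b) = x ∧ t (e, b) = y := by
  have h : ∀ e, ∃ x y, G.IsLink e x y := fun e => exists_isLink_of_mem_edgeSet (by simp [hG])
  choose a b hab using h
  refine ⟨fun d => if d.2 then a d.1 else b d.1, fun d => if d.2 then b d.1 else a d.1, ?_, ?_⟩
  · rintro ⟨e, _ | _⟩
    · simpa using (hab e).symm
    · simpa using hab e
  · intro e x y h
    rcases (hab e).eq_and_eq_or_eq_and_eq h with ⟨h1, h2⟩ | ⟨h1, h2⟩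
    · exact ⟨true, by simpa using ⟨h1, h2⟩⟩
    · exact ⟨false, by simpa using ⟨h2, h1⟩⟩

/-- After contracting `C`, there are at most `(2 |β|) ^ n` cycles (as sets of the form `C' \ C`)
whose length is in `((n - 1) (k + 1), n (k + 1)]`. -/
theorem GirthModGT.card_le [Fintype β] {k : ℕ} (hg : G.GirthModGT C (2 * k))
    (hG : G.edgeSet = Set.univ) (n : ℕ) (hn : n ≠ 0) (𝒯 : Finset (Finset β))
    (h𝒯 : ∀ T ∈ 𝒯, (∃ C' : Finset β, G.IsCycle (C' : Set β) ∧ T = C' \ C) ∧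
      T.card ≤ n * (k + 1) ∧ n * (k + 1) < T.card + (k + 1)) :
    𝒯.card ≤ (2 * Fintype.card β) ^ n := by
  classical
  obtain ⟨s, t, hst, hlink⟩ := exists_source_target hG
  -- The walk is closed, so the source of its first edge also serves as its end and need not be
  -- recorded. The value at `[]` is immaterial because `n ≠ 0`.
  let F : List (β × Bool) → Finset β
    | [] => ∅
    | d :: c => G.decode C s t k (d :: c) (s d)
  have hsub : 𝒯 ⊆ (Finset.univ : Finset (List.Vector (β × Bool) n)).image fun c => F c.toList := by
    intro T hT
    obtain ⟨⟨C', hC', hTC⟩, h1, h2⟩ := h𝒯 T hT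
    obtain ⟨x, l, hw, hnd, hl⟩ := hC'.exists_isWalkMod hlink C
    have hw' := hw.filter hst
    set l' := l.filter fun d => d.1 ∉ C with hl'
    have hnd' : (l'.map Prod.fst).Nodup := hnd.sublist (List.filter_sublist.map _)
    have hT' : (l'.map Prod.fst).toFinset = T := by
      rw [hTC, ← hl]
      ext e
      simp only [hl', List.mem_toFinset, List.mem_map, List.mem_filter, Finset.mem_sdiff,
        decide_eq_true_eq]
      constructor
      · rintro ⟨d, ⟨hd, hd'⟩, rfl⟩; exact ⟨⟨d, hd, rfl⟩, hd'⟩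
      · rintro ⟨⟨d, hd, rfl⟩, hd'⟩; exact ⟨d, ⟨hd, hd'⟩, rfl⟩
    have hlen : l'.length = T.card := by
      rw [← hT', List.toFinset_card_of_nodup hnd', List.length_map]
    have hCl : ∀ d ∈ l', d.1 ∉ C := by
      intro d hd
      simpa using (List.mem_filter.1 hd).2
    rw [← hlen] at h1 h2
    rw [← hT', ← oddEdges_of_nodup hnd']
    clear_value l'
    cases l' with
    | nil =>
      exfalso
      rcases n with _ | n
      · exact hn rfl
      · simp [add_mul] at h2; omega
    | cons d l' =>
      obtain ⟨c, hc, hc', hc''⟩ := hg.exists_decode_eq hst n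
        (x := s d) (l := d :: l') (IsWalkMod.congr_right hw'.1 ⟨Congr.refl _ _, hw'.2⟩) hCl h1 h2
      cases c with
      | nil => simp at hc'
      | cons d' c =>
        obtain rfl : d' = d := by simpa using hc'
        exact Finset.mem_image.2 ⟨⟨d' :: c, hc⟩, Finset.mem_univ _, hc''⟩
  refine (Finset.card_le_card hsub).trans (Finset.card_image_le.trans ?_)
  rw [Finset.card_univ, card_vector, Fintype.card_prod, Fintype.card_bool, mul_comm]

end

end Graph

/-! ### Girth after contracting a nearly shortest cycle -/

namespace Graph

variable {V β : Type*} {G : Graph V β} [DecidableEq β]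

/-- Both `A ∪ D` and `(C \ A) ∪ D` are even and nonempty, so each has at least `l` edges. Adding the
two bounds gives `2 l ≤ 2 |D| + |C|`, so `|D| ≥ 0.495 l`, which exceeds `2 (l - 1) / 5`. -/
theorem HasMinCycleLength.girthModGT {l : ℕ} (hl : G.HasMinCycleLength l)
    (hG : G.edgeSet = Set.univ) {C : Finset β} (hC : G.IsCycle (C : Set β))
    (hCl : 100 * C.card ≤ 101 * l) : G.GirthModGT C (2 * ((l - 1) / 5)) := by
  intro A D hA hD hD0 hs
  have hsub : ∀ D : Finset β, (D : Set β) ⊆ G.edgeSet := fun D => by simp [hG]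
  have hl0 : 0 < l := by
    have := Finset.card_pos.2 (Finset.coe_nonempty.1 hC.nonempty)
    by_contra h
    have : l = 0 := by omega
    subst this; omega
  have key : ∀ A' ⊆ C, ∑ e ∈ A', G.bd e = ∑ e ∈ D, G.bd e → l ≤ D.card + A'.card := by
    intro A' hA' hs'
    rw [← Finset.card_union_of_disjoint (hD.mono_right hA')]
    refine IsEven.le_card hl ?_ (hD0.mono Finset.subset_union_left) (hsub _)
    rw [IsEven, Finset.sum_union (hD.mono_right hA'), hs', ZModModule.add_self]
  have h1 := key A hA hs
  have h2 := key (C \ A) Finset.sdiff_subset (by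
    have h3 := Finset.sum_sdiff (f := G.bd) hA
    rw [hC.isEven] at h3
    rw [eq_neg_of_add_eq_zero_left h3, ZModModule.neg_eq_self, hs])
  rw [Finset.card_sdiff_of_subset hA] at h2
  have h4 := Finset.card_le_card hA
  omega

end Graph

/-! ### A random edge set isolates a given cycle -/

/-- The probability of `S` if each element is chosen independently with probability `p`. -/
def bernoulliWeight {β : Type*} [Fintype β] [DecidableEq β] (p : ℝ) (S : Finset β) : ℝ :=
  p ^ S.card * (1 - p) ^ Sᶜ.card

section

variable {β : Type*} [Fintype β] [DecidableEq β]

theorem bernoulliWeight_nonneg {p : ℝ} (h0 : 0 ≤ p) (h1 : p ≤ 1) (S : Finset β) :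
    0 ≤ bernoulliWeight p S :=
  mul_nonneg (pow_nonneg h0 _) (pow_nonneg (sub_nonneg.2 h1) _)

theorem sum_bernoulliWeight_superset (p : ℝ) (A : Finset β) :
    ∑ S : Finset β with A ⊆ S, bernoulliWeight p S = p ^ A.card := by
  -- Giving weight zero to the omission of an element of `A` leaves only the supersets of `A` in the
  -- expanded product.
  have h := Fintype.prod_add (fun _ : β => p) (fun e => if e ∈ A then 0 else 1 - p)
  have h1 : ∏ e : β, (p + if e ∈ A then 0 else 1 - p) = p ^ A.card := by
    rw [← Finset.prod_mul_prod_compl A, Finset.prod_congr rfl (g := fun _ => p)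
      (fun e he => by simp [he]), Finset.prod_const, Finset.prod_congr rfl (g := fun _ => (1 : ℝ))
      (fun e he => by simp [Finset.mem_compl.1 he])]
    simp
  rw [← h1, h, Finset.sum_filter]
  refine Finset.sum_congr rfl fun S _ => ?_
  rw [Finset.prod_const]
  split_ifs with hA
  · rw [bernoulliWeight, Finset.prod_congr rfl (g := fun _ => 1 - p), Finset.prod_const]
    intro e he
    rw [if_neg fun heA => Finset.mem_compl.1 he (hA heA)]
  · obtain ⟨e, heA, heS⟩ := Finset.not_subset.1 hA
    rw [Finset.prod_eq_zero (Finset.mem_compl.2 heS) (by simp [heA]), mul_zero]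

theorem sum_bernoulliWeight (p : ℝ) : ∑ S : Finset β, bernoulliWeight p S = 1 := by
  simpa using sum_bernoulliWeight_superset p (∅ : Finset β)

/-- The union bound. -/
theorem Finset.sum_filter_le_add_sum_sum_filter {Ω ι : Type*} [Fintype Ω] {w : Ω → ℝ}
    (hw : ∀ S, 0 ≤ w S) (P Q : Ω → Prop) (𝒯 : Finset ι) (R : ι → Ω → Prop) [DecidablePred P]
    [DecidablePred Q] [∀ T, DecidablePred (R T)]
    (h : ∀ S, P S → Q S ∨ ∃ T ∈ 𝒯, R T S) :
    ∑ S with P S, w S ≤ ∑ S with Q S, w S + ∑ T ∈ 𝒯, ∑ S with R T S, w S := by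
  simp_rw [Finset.sum_filter]
  rw [Finset.sum_comm, ← Finset.sum_add_distrib]
  refine Finset.sum_le_sum fun S _ => ?_
  have hnn : ∀ T ∈ 𝒯, 0 ≤ if R T S then w S else 0 := by
    intro T _; split_ifs <;> simp [hw]
  have hQ : 0 ≤ if Q S then w S else 0 := by split_ifs <;> simp [hw]
  split_ifs with hP hQ'
  · exact le_add_of_nonneg_right (Finset.sum_nonneg hnn)
  · obtain ⟨T, hT, hR⟩ := (h S hP).resolve_left hQ'
    have := Finset.single_le_sum hnn hT
    rw [if_pos hR] at this
    simpa using this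
  · exact add_nonneg (hw S) (Finset.sum_nonneg hnn)
  · simpa using Finset.sum_nonneg hnn

theorem sum_Icc_quarter_pow_le (N : ℕ) : ∑ n ∈ Finset.Icc 1 N, (1 / 4 : ℝ) ^ n ≤ 1 / 2 := by
  have h : ∑ n ∈ Finset.Icc 1 N, (1 / 4 : ℝ) ^ n = (1 - (1 / 4) ^ N) / 3 := by
    induction N with
    | zero => simp
    | succ N ih => rw [Finset.sum_Icc_succ_top (by omega), ih, pow_succ]; ring
  rw [h]
  have : (0 : ℝ) < (1 / 4) ^ N := by positivity
  linarith

/-- `C` is the only nonempty subset of `S` that satisfies `P`. -/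
def Isolates {β : Type*} (P : Finset β → Prop) (C S : Finset β) : Prop :=
  ∀ Z : Finset β, Z.Nonempty ∧ P Z ∧ Z ⊆ S ↔ Z = C

namespace Graph

variable {V : Type*} {G : Graph V β}

/-- If `C'` were a proper subset of `C`, then `C'` and `C \ C'` would be disjoint nonempty even
sets, forcing `|C| ≥ 2 l`. -/
theorem HasMinCycleLength.sdiff_nonempty {l : ℕ} (hl : G.HasMinCycleLength l)
    (hG : G.edgeSet = Set.univ) {C C' : Finset β} (hC : G.IsCycle (C : Set β))
    (hCl : 100 * C.card ≤ 101 * l) (hC' : G.IsCycle (C' : Set β)) (hne : C' ≠ C) :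
    (C' \ C).Nonempty := by
  rw [Finset.nonempty_iff_ne_empty, Ne, Finset.sdiff_eq_empty_iff_subset]
  intro hsub
  have hsub' : ∀ D : Finset β, (D : Set β) ⊆ G.edgeSet := fun D => by simp [hG]
  have h1 := IsEven.le_card hl hC'.isEven (Finset.coe_nonempty.1 hC'.nonempty) (hsub' _)
  have h2 := IsEven.le_card hl (hC.isEven.symmDiff hC'.isEven)
    (Finset.nonempty_iff_ne_empty.2 fun h => hne (symmDiff_eq_bot.1 h).symm) (hsub' _)
  rw [symmDiff_of_ge hsub, Finset.card_sdiff_of_subset hsub] at h2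
  have h3 := Finset.card_le_card hsub
  have h4 := Finset.card_pos.2 (Finset.coe_nonempty.1 hC'.nonempty)
  omega

/-- Given that `C` is chosen, this bounds the expected number of sets `C' \ C` that are chosen too.
Grouped by the number `n` of marks in their encoding, they contribute at most `(2 j) ^ n * (8 j) ^
(-n) = 4 ^ (-n)`, with `j` the number of edges. -/
theorem HasMinCycleLength.sum_pow_card_le {l : ℕ} (hl : G.HasMinCycleLength l)
    (hG : G.edgeSet = Set.univ) {C : Finset β} (hC : G.IsCycle (C : Set β))
    (hCl : 100 * C.card ≤ 101 * l) {p : ℝ} (hp0 : 0 < p) (hp1 : p ≤ 1)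
    (hp : p ^ ((l - 1) / 5 + 1) = ((8 * Fintype.card β : ℝ) ^ 2)⁻¹) (𝒯 : Finset (Finset β))
    (h𝒯 : ∀ T ∈ 𝒯, ∃ C' : Finset β, G.IsCycle (C' : Set β) ∧ C' ≠ C ∧ T = C' \ C) :
    ∑ T ∈ 𝒯, p ^ T.card ≤ 1 / 2 := by
  have hg := hl.girthModGT hG hC hCl
  set k := (l - 1) / 5 with hk
  have hj : 0 < Fintype.card β := by
    obtain ⟨e, -⟩ := hC.nonempty
    exact Fintype.card_pos_iff.2 ⟨e⟩
  have hT0 : ∀ T ∈ 𝒯, T.Nonempty := by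
    intro T hT
    obtain ⟨C', hC', hne, rfl⟩ := h𝒯 T hT
    exact hl.sdiff_nonempty hG hC hCl hC' hne
  have hTk : ∀ T ∈ 𝒯, 2 * k < T.card := by
    intro T hT
    have hT0 := hT0 T hT
    obtain ⟨C', hC', -, rfl⟩ := h𝒯 T hT
    refine hg (C' ∩ C) _ Finset.inter_subset_right Finset.sdiff_disjoint hT0 ?_
    have h1 := Finset.sum_inter_add_sum_sdiff C' C G.bd
    rw [hC'.isEven] at h1
    rw [eq_neg_of_add_eq_zero_left h1, ZModModule.neg_eq_self]
  -- This is `|T| / (k + 1)` rounded up, the number of marks in the encoding of `T`.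
  let f : Finset β → ℕ := fun T => (T.card + k) / (k + 1)
  have hf : ∀ T, f T * (k + 1) ≤ T.card + k ∧ T.card + k < f T * (k + 1) + (k + 1) := by
    intro T
    have h1 : f T * (k + 1) + (T.card + k) % (k + 1) = T.card + k := Nat.div_add_mod' _ _
    have h2 : (T.card + k) % (k + 1) < k + 1 := Nat.mod_lt _ k.succ_pos
    exact ⟨by omega, by omega⟩
  have hmaps : ∀ T ∈ 𝒯, f T ∈ Finset.Icc 1 (Fintype.card β) := by
    intro T hT
    obtain ⟨h1, h2⟩ := hf T
    have h3 := Finset.card_pos.2 (hT0 T hT)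
    have h4 := Finset.card_le_univ T
    rw [Finset.mem_Icc]
    constructor
    · by_contra h
      have : f T = 0 := by omega
      rw [this] at h2; omega
    · refine le_trans ?_ h4
      refine Nat.div_le_of_le_mul ?_
      have : k ≤ k * T.card := Nat.le_mul_of_pos_right _ h3
      rw [add_mul]; omega
  rw [← Finset.sum_fiberwise_of_maps_to hmaps]
  refine le_trans (Finset.sum_le_sum fun n hn => ?_) (sum_Icc_quarter_pow_le (Fintype.card β))
  rw [Finset.mem_Icc] at hn
  have hcard := hg.card_le hG n (by omega) (𝒯.filter fun T => f T = n) (by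
    intro T hT
    rw [Finset.mem_filter] at hT
    obtain ⟨C', hC', -, rfl⟩ := h𝒯 T hT.1
    obtain ⟨h1, h2⟩ := hf (C' \ C)
    rw [hT.2] at h1 h2
    exact ⟨⟨C', hC', rfl⟩, by omega, by omega⟩)
  have hj' : (0 : ℝ) < Fintype.card β := by exact_mod_cast hj
  -- After squaring, the claim is `2 |T| ≥ n (k + 1)`, which follows from `n (k + 1) ≤ |T| + k` and
  -- `|T| > 2 k`. The girth bound thus absorbs the loss from rounding up.
  have hpow : ∀ T ∈ 𝒯.filter fun T => f T = n, p ^ T.card ≤ ((8 * Fintype.card β : ℝ) ^ n)⁻¹ := by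
    intro T hT
    rw [Finset.mem_filter] at hT
    have h1 := (hf T).1
    have h2 := hTk T hT.1
    rw [hT.2] at h1
    rw [← pow_le_pow_iff_left₀ (by positivity) (by positivity) two_ne_zero, ← pow_mul, inv_pow,
      ← pow_mul, mul_comm n 2, pow_mul _ 2 n, ← inv_pow, ← hp, ← pow_mul]
    exact pow_le_pow_of_le_one hp0.le hp1 (by rw [mul_comm _ n]; omega)
  refine (Finset.sum_le_card_nsmul _ _ _ hpow).trans ?_
  rw [nsmul_eq_mul]
  calc _ ≤ (((2 * Fintype.card β) ^ n : ℕ) : ℝ) * ((8 * Fintype.card β : ℝ) ^ n)⁻¹ := by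
        gcongr
    _ = (1 / 4 : ℝ) ^ n := by
        push_cast
        rw [← inv_pow, ← mul_pow]
        congr 1
        field_simp
        norm_num

/-- A nonempty even set inside `S` contains a cycle, which must be `C`. Removing `C` leaves an even
set; if nonempty, it would contain a cycle disjoint from `C`. -/
theorem IsCycle.isolates_of_forall (hG : G.edgeSet = Set.univ) {C S : Finset β}
    (hC : G.IsCycle (C : Set β)) (hCS : C ⊆ S)
    (h : ∀ C' : Finset β, G.IsCycle (C' : Set β) → C' ⊆ S → C' = C) :
    Isolates G.IsEven C S := by
  have hsub : ∀ D : Finset β, (D : Set β) ⊆ G.edgeSet := fun D => by simp [hG]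
  have hC0 := Finset.coe_nonempty.1 hC.nonempty
  intro Z
  constructor
  · rintro ⟨hZ0, hZ, hZS⟩
    obtain ⟨C', hC'Z, hC'⟩ := hZ.exists_isCycle hZ0 (hsub _)
    have hCC := h C' hC' (hC'Z.trans hZS)
    subst hCC
    by_contra hne
    obtain ⟨C'', hC''Z, hC''⟩ := (hZ.symmDiff hC.isEven).exists_isCycle
      (Finset.nonempty_iff_ne_empty.2 fun h => hne (symmDiff_eq_bot.1 h)) (hsub _)
    rw [symmDiff_of_ge hC'Z] at hC''Z
    have h1 := h C'' hC'' (hC''Z.trans (Finset.sdiff_subset.trans hZS))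
    subst h1
    obtain ⟨e, he⟩ := hC0
    exact (Finset.mem_sdiff.1 (hC''Z he)).2 he
  · rintro rfl
    exact ⟨hC0, hC.isEven, hCS⟩

open Classical in
theorem HasMinCycleLength.le_sum_isolates {l : ℕ} (hl : G.HasMinCycleLength l)
    (hG : G.edgeSet = Set.univ) {C : Finset β} (hC : G.IsCycle (C : Set β))
    (hCl : 100 * C.card ≤ 101 * l) {p : ℝ} (hp0 : 0 < p) (hp1 : p ≤ 1)
    (hp : p ^ ((l - 1) / 5 + 1) = ((8 * Fintype.card β : ℝ) ^ 2)⁻¹) :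
    (2 * (8 * Fintype.card β : ℝ) ^ 12)⁻¹ ≤
      ∑ S : Finset β with Isolates G.IsEven C S, bernoulliWeight p S := by
  let 𝒯 : Finset (Finset β) :=
    {T | ∃ C' : Finset β, G.IsCycle (C' : Set β) ∧ C' ≠ C ∧ T = C' \ C}
  have h𝒯 : ∀ T ∈ 𝒯, ∃ C' : Finset β, G.IsCycle (C' : Set β) ∧ C' ≠ C ∧ T = C' \ C := by
    intro T hT
    simpa [𝒯] using hT
  have h1 := Finset.sum_filter_le_add_sum_sum_filter (bernoulliWeight_nonneg (β := β) hp0.le hp1)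
    (fun S => C ⊆ S) (fun S => Isolates G.IsEven C S) 𝒯 (fun T S => C ∪ T ⊆ S) (by
      intro S hCS
      by_contra hcon
      push Not at hcon
      refine hcon.1 (hC.isolates_of_forall hG hCS fun C' hC' hC'S => ?_)
      by_contra hne
      refine hcon.2 (C' \ C) (by simpa [𝒯] using ⟨C', hC', hne, rfl⟩) ?_
      exact Finset.union_subset hCS (Finset.sdiff_subset.trans hC'S))
  simp_rw [sum_bernoulliWeight_superset] at h1
  have h2 : ∑ T ∈ 𝒯, p ^ (C ∪ T).card = p ^ C.card * ∑ T ∈ 𝒯, p ^ T.card := by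
    rw [Finset.mul_sum]
    refine Finset.sum_congr rfl fun T hT => ?_
    obtain ⟨C', -, -, rfl⟩ := h𝒯 T hT
    rw [Finset.card_union_of_disjoint Finset.disjoint_sdiff, pow_add]
  have h3 := hl.sum_pow_card_le hG hC hCl hp0 hp1 hp 𝒯 h𝒯
  have h4 : 0 < p ^ C.card := by positivity
  -- The exponent 12 is `2 * 6`: `|C| ≤ 1.01 l` and `l ≤ 5 (k + 1)` for `k = (l - 1) / 5`, so `|C| ≤
  -- 6 (k + 1)`.
  have h5 : ((8 * Fintype.card β : ℝ) ^ 12)⁻¹ ≤ p ^ C.card := by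
    rw [show 12 = 2 * 6 from rfl, pow_mul, ← inv_pow, ← hp, ← pow_mul]
    exact pow_le_pow_of_le_one hp0.le hp1 (by omega)
  rw [h2] at h1
  rw [mul_inv]
  nlinarith

end Graph

end

/-! ### Derandomization: one family for all graphs -/

/-- Greedy choice: a random `S` hits on average at least a fraction `δ` of the requirements still
unmet, so some `S` does, and adding it shrinks their number by the factor `1 - δ`. -/
theorem exists_finset_hitting {Ω R : Type*} [Fintype Ω] [DecidableEq Ω] [Fintype R] {w : Ω → ℝ}
    (hw : ∀ S, 0 ≤ w S) (hw1 : ∑ S, w S = 1) (H : R → Ω → Prop) [∀ r, DecidablePred (H r)] {δ : ℝ}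
    (hδ : δ ≤ 1) (hH : ∀ r, δ ≤ ∑ S with H r S, w S) (N : ℕ) :
    ∃ F : Finset Ω, F.card ≤ N ∧
      (({r | ∀ S ∈ F, ¬ H r S} : Finset R).card : ℝ) ≤ (1 - δ) ^ N * Fintype.card R := by
  induction N with
  | zero => exact ⟨∅, by simp, by simp⟩
  | succ N ih =>
    obtain ⟨F, hF, hU⟩ := ih
    set U : Finset R := {r | ∀ S ∈ F, ¬ H r S} with hUdef
    obtain ⟨S, hS⟩ : ∃ S, δ * U.card ≤ (U.filter fun r => H r S).card := by
      by_contra hcon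
      push Not at hcon
      have h1 : δ * U.card ≤ ∑ S, w S * (U.filter fun r => H r S).card := by
        calc δ * U.card = ∑ r ∈ U, δ := by simp [mul_comm]
          _ ≤ ∑ r ∈ U, ∑ S with H r S, w S := Finset.sum_le_sum fun r _ => hH r
          _ = ∑ S, ∑ r ∈ U, if H r S then w S else 0 := by
            simp_rw [Finset.sum_filter]; exact Finset.sum_comm
          _ = _ := by
            refine Finset.sum_congr rfl fun S _ => ?_
            rw [← Finset.sum_filter, Finset.sum_const, nsmul_eq_mul, mul_comm]
      have h2 : ∑ S, w S * (U.filter fun r => H r S).card < ∑ S, w S * (δ * U.card) := by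
        refine Finset.sum_lt_sum (fun S _ => mul_le_mul_of_nonneg_left (hcon S).le (hw S)) ?_
        obtain ⟨S, hS, hpos⟩ : ∃ S ∈ Finset.univ, 0 < w S := by
          by_contra h
          push Not at h
          have := Finset.sum_nonpos h
          rw [hw1] at this
          linarith
        exact ⟨S, hS, mul_lt_mul_of_pos_left (hcon S) hpos⟩
      rw [← Finset.sum_mul, hw1, one_mul] at h2
      linarith
    refine ⟨insert S F, (Finset.card_insert_le _ _).trans (by omega), ?_⟩
    have h3 : ({r | ∀ S' ∈ insert S F, ¬ H r S'} : Finset R) = U.filter fun r => ¬ H r S := by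
      ext r
      simp [hUdef, and_comm]
    have h4 := Finset.card_filter_add_card_filter_not (s := U) (fun r => H r S)
    have h5 : ((U.filter fun r => H r S).card : ℝ) + (U.filter fun r => ¬ H r S).card = U.card := by
      exact_mod_cast h4
    rw [h3]
    calc _ ≤ (1 - δ) * U.card := by linarith
      _ ≤ (1 - δ) * ((1 - δ) ^ N * Fintype.card R) :=
        mul_le_mul_of_nonneg_left hU (sub_nonneg.2 hδ)
      _ = _ := by ring

/-- The linear relations among vectors over `ZMod 2` are those among vectors of bounded
dimension. -/
theorem exists_coordinates {ι W : Type*} [Fintype ι] [DecidableEq ι] [AddCommGroup W]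
    [Module (ZMod 2) W] (f : ι → W) :
    ∃ c : ι → ι → ZMod 2, ∀ Z : Finset ι, ∑ i ∈ Z, c i = 0 ↔ ∑ i ∈ Z, f i = 0 := by
  let L : (ι → ZMod 2) →ₗ[ZMod 2] W := Fintype.linearCombination (ZMod 2) f
  -- A projection along the kernel of `L` has the same kernel as `L`, but its values lie in `ι →
  -- ZMod 2`.
  obtain ⟨q, hq⟩ := Submodule.exists_isCompl (LinearMap.ker L)
  refine ⟨fun i => Submodule.projection q (LinearMap.ker L) hq.symm (Pi.single i 1), fun Z => ?_⟩
  rw [← map_sum, ← LinearMap.mem_ker, Submodule.ker_projection, LinearMap.mem_ker, map_sum]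
  simp [L, Fintype.linearCombination_apply_single]

theorem pow_mul_two_pow_lt_one {K : ℝ} (hK : 1 ≤ K) {n N : ℕ} (hN : K * (n + 1) ≤ N) :
    (1 - K⁻¹) ^ N * 2 ^ n < 1 := by
  have hK0 : 0 < K := by linarith
  have h0 : 0 ≤ 1 - K⁻¹ := sub_nonneg.2 (inv_le_one_of_one_le₀ hK)
  have h1 : (1 - K⁻¹) ^ N ≤ Real.exp (-(n + 1)) := by
    calc (1 - K⁻¹) ^ N ≤ (Real.exp (-K⁻¹)) ^ N := by
          gcongr
          exact Real.one_sub_le_exp_neg _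
      _ = Real.exp (-(N * K⁻¹)) := by rw [← Real.exp_nat_mul]; ring_nf
      _ ≤ _ := by
        rw [Real.exp_le_exp, neg_le_neg_iff, ← div_eq_mul_inv, le_div_iff₀ hK0]
        linarith
  have h2 : (2 : ℝ) ^ n ≤ Real.exp n := by
    calc (2 : ℝ) ^ n ≤ (Real.exp 1) ^ n := by
          gcongr
          linarith [Real.exp_one_gt_d9]
      _ = _ := by rw [← Real.exp_nat_mul, mul_one]
  calc _ ≤ Real.exp (-(n + 1)) * Real.exp n := by gcongr
    _ = Real.exp (-1) := by rw [← Real.exp_add]; ring_nf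
    _ < 1 := by simp

/-- The bound on the size of the universal families. -/
noncomputable def familySize : Polynomial ℕ :=
  Polynomial.C 2 * (Polynomial.C 8 * Polynomial.X) ^ 12 * (Polynomial.X * Polynomial.X +
    Polynomial.X + 1)

theorem eval_familySize (j : ℕ) :
    familySize.eval j = 2 * (8 * j) ^ 12 * (j * j + j + 1) := by
  simp [familySize]

theorem exists_pow_eq_inv {K : ℝ} (hK : 1 ≤ K) (n : ℕ) :
    ∃ p : ℝ, 0 < p ∧ p ≤ 1 ∧ p ^ (n + 1) = K⁻¹ := by
  have hK0 : 0 < K := by linarith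
  refine ⟨K⁻¹ ^ ((n + 1 : ℕ) : ℝ)⁻¹, by positivity, ?_, ?_⟩
  · exact Real.rpow_le_one (by positivity) (inv_le_one_of_one_le₀ hK) (by positivity)
  · exact Real.rpow_inv_natCast_pow (by positivity) (by omega)

theorem exists_universal_family (j l : ℕ) : ∃ F : Finset (Finset (Fin j)),
    F.card ≤ familySize.eval j ∧
      ∀ (V : Type u) (G : Graph V (Fin j)), G.edgeSet = Set.univ → G.HasMinCycleLength l →
        ∀ C : Finset (Fin j), G.IsCycle (C : Set (Fin j)) → 100 * C.card ≤ 101 * l →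
          ∃ S ∈ F, Isolates G.IsEven C S := by
  classical
  rcases Nat.eq_zero_or_pos j with rfl | hj
  · refine ⟨∅, by simp, fun V G _ _ C hC _ => ?_⟩
    obtain ⟨e, -⟩ := hC.nonempty
    exact e.elim0
  have hj' : (1 : ℝ) ≤ j := by exact_mod_cast hj
  have hK : (1 : ℝ) ≤ 2 * (8 * j : ℝ) ^ 12 := by
    have : (1 : ℝ) ≤ (8 * j : ℝ) ^ 12 := one_le_pow₀ (by linarith)
    linarith
  obtain ⟨p, hp0, hp1, hp⟩ := exists_pow_eq_inv (K := (8 * j : ℝ) ^ 2)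
    (one_le_pow₀ (by linarith)) ((l - 1) / 5)
  let δ : ℝ := (2 * (8 * j : ℝ) ^ 12)⁻¹
  -- The graph is replaced by `j` vectors with the same linear relations as its edge boundaries.
  -- This leaves finitely many requirements, whatever the vertex type.
  let H : (Fin j → Fin j → ZMod 2) × Finset (Fin j) → Finset (Fin j) → Prop :=
    fun r S => Isolates (fun Z => ∑ e ∈ Z, r.1 e = 0) r.2 S
  -- Arbitrary vectors need not come from a graph, so only pairs with a large isolation probability
  -- are required to be hit.
  let R := {r // δ ≤ ∑ S with H r S, bernoulliWeight p S}
  obtain ⟨F, hF, hU⟩ := exists_finset_hitting (bernoulliWeight_nonneg hp0.le hp1)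
    (sum_bernoulliWeight (β := Fin j) p) (fun r : R => H r.1) (inv_le_one_of_one_le₀ hK)
    (fun r => r.2) (familySize.eval j)
  have hR : (Fintype.card R : ℝ) ≤ 2 ^ (j * j + j) := by
    have h1 : Fintype.card R ≤ 2 ^ (j * j + j) := by
      refine (Fintype.card_subtype_le _).trans (le_of_eq ?_)
      rw [Fintype.card_prod, Fintype.card_finset, Fintype.card_fun, Fintype.card_fun,
        ZMod.card, Fintype.card_fin, ← pow_mul, pow_add]
    exact_mod_cast h1
  -- `familySize` is `δ⁻¹ (j * j + j + 1)`, enough greedy steps to push at most `2 ^ (j * j + j)`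
  -- requirements below one.
  have hlt : (({r | ∀ S ∈ F, ¬ H r.1 S} : Finset R).card : ℝ) < 1 := by
    refine hU.trans_lt (lt_of_le_of_lt (mul_le_mul_of_nonneg_left hR ?_)
      (pow_mul_two_pow_lt_one hK (n := j * j + j) (le_of_eq ?_)))
    · exact pow_nonneg (sub_nonneg.2 (inv_le_one_of_one_le₀ hK)) _
    · rw [eval_familySize]; push_cast; ring
  have hempty : ({r | ∀ S ∈ F, ¬ H r.1 S} : Finset R) = ∅ := by
    rw [← Finset.card_eq_zero]
    exact Nat.lt_one_iff.1 (by exact_mod_cast hlt)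
  refine ⟨F, hF, fun V G hG hl C hC hCl => ?_⟩
  obtain ⟨c, hc⟩ := exists_coordinates G.bd
  have hiff : (fun Z : Finset (Fin j) => ∑ e ∈ Z, c e = 0) = G.IsEven :=
    funext fun Z => propext (hc Z)
  have hheavy : δ ≤ ∑ S with H (c, C) S, bernoulliWeight p S := by
    have := hl.le_sum_isolates hG hC hCl hp0 hp1 (by simpa using hp)
    simp only [H, hiff]
    simpa [δ] using this
  have hmem := Finset.notMem_empty (⟨(c, C), hheavy⟩ : R)
  rw [← hempty, Finset.mem_filter] at hmem
  push Not at hmem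
  obtain ⟨S, hS, hH⟩ := hmem (Finset.mem_univ _)
  refine ⟨S, hS, ?_⟩
  simpa only [H, hiff] using hH

theorem exists_isUniversal :
    ∃ B : QueryFamilies, QueryFamilies.IsUniversal.{u} B ∧ B.HasSize familySize := by
  choose B hB hU using exists_universal_family.{u}
  refine ⟨B, ?_, hB⟩
  intro j l V G hG hl C hC _ hCl
  have hfin := C.toFinite
  obtain ⟨C, rfl⟩ : ∃ C' : Finset (Fin j), (C' : Set (Fin j)) = C := ⟨hfin.toFinset, by simp⟩
  rw [Set.ncard_coe_finset] at hCl
  have hCl' : 100 * C.card ≤ 101 * l := by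
    have : (100 * C.card : ℝ) ≤ 101 * l := by linarith
    exact_mod_cast this
  obtain ⟨S, hS, hiso⟩ := hU j l V G hG hl C hC hCl'
  refine ⟨S, hS, fun C' => ⟨fun h => ?_, ?_⟩⟩
  · obtain ⟨hC', hC'S⟩ := h
    obtain ⟨C', rfl⟩ : ∃ D : Finset (Fin j), (D : Set (Fin j)) = C' :=
      ⟨C'.toFinite.toFinset, by simp⟩
    exact congrArg _ ((hiso C').1 ⟨Finset.coe_nonempty.1 hC'.nonempty, hC'.isEven,
      Finset.coe_subset.1 hC'S⟩)
  · rintro rfl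
    exact ⟨hC, Finset.coe_subset.2 ((hiso C).2 rfl).2.2⟩

/-! ### Relabelling the edges, and the independence oracle -/

namespace Graph

/-- The graph with edge set `γ` in which `e` joins the ends of `φ e`. -/
def reindex {V β γ : Type*} (G : Graph V β) (φ : γ → β) : Graph V γ where
  vertexSet := G.vertexSet
  IsLink e x y := G.IsLink (φ e) x y
  isLink_symm _ _ := ⟨fun _ _ h => h.symm⟩
  eq_or_eq_of_isLink_of_isLink _ _ _ _ _ h h' := G.eq_or_eq_of_isLink_of_isLink h h'
  left_mem_of_isLink _ _ _ h := G.left_mem_of_isLink h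

variable {V β γ : Type*} {G : Graph V β}

theorem reindex_edgeSet (φ : γ → β) (hG : G.edgeSet = Set.univ) :
    (G.reindex φ).edgeSet = Set.univ := by
  refine Set.eq_univ_of_forall fun e => ?_
  obtain ⟨x, y, h⟩ := exists_isLink_of_mem_edgeSet (show φ e ∈ G.edgeSet by simp [hG])
  exact ⟨x, y, h⟩

theorem isCycle_reindex_iff {φ : γ → β} (hφ : Function.Injective φ) {C : Set γ} :
    (G.reindex φ).IsCycle C ↔ G.IsCycle (φ '' C) := by
  constructor
  · rintro ⟨n, v, e, hv, he, hl, rfl⟩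
    exact ⟨n, v, φ ∘ e, hv, hφ.comp he, hl, Set.range_comp φ e⟩
  · rintro ⟨n, v, e, hv, he, hl, hr⟩
    have h : ∀ i, ∃ f, φ f = e i := fun i => by
      obtain ⟨f, -, hf⟩ : e i ∈ φ '' C := hr ▸ ⟨i, rfl⟩
      exact ⟨f, hf⟩
    choose f hf using h
    obtain rfl : φ ∘ f = e := funext hf
    refine ⟨n, v, f, hv, he.of_comp, hl, ?_⟩
    rw [Set.range_comp] at hr
    exact hφ.image_injective hr

theorem cycleMatroid_indep_iff [Finite β] {I : Set β} :
    G.cycleMatroid.Indep I ↔ G.IsAcyclicSet I :=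
  Iff.rfl

theorem cycleMatroid_ground [Finite β] : G.cycleMatroid.E = G.edgeSet :=
  rfl

theorem not_indep_cycleMatroid [Finite β] {C I : Set β} (hC : G.IsCycle C) (hCI : C ⊆ I) :
    ¬ G.cycleMatroid.Indep I := fun h => (cycleMatroid_indep_iff.1 h).2 C hC hCI

theorem indep_cycleMatroid [Finite β] (hG : G.edgeSet = Set.univ) {I : Set β}
    (h : ∀ C, G.IsCycle C → ¬ C ⊆ I) : G.cycleMatroid.Indep I :=
  cycleMatroid_indep_iff.2 ⟨by simp [hG], h⟩

end Graph

theorem indepOracle_eq_true_iff {m : ℕ} {M : Matroid (Fin m)} {S : Finset (Fin m)} :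
    indepOracle M S = true ↔ M.Indep (S : Set (Fin m)) := by
  simp [indepOracle]

theorem indepOracle_eq_false_iff {m : ℕ} {M : Matroid (Fin m)} {S : Finset (Fin m)} :
    indepOracle M S = false ↔ ¬ M.Indep (S : Set (Fin m)) := by
  simp [indepOracle]

/-! ### Decision trees that iterate one round -/

namespace ParallelTree

variable {m : ℕ}

/-- The parallel algorithm with state space `Finset (Fin m)` that in state `E` submits the sets in
`𝒬 E`, and from the answers computes the next state. After `n` rounds it outputs the state. -/
noncomputable def iterated (𝒬 : Finset (Fin m) → Finset (Finset (Fin m)))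
    (upd : Finset (Fin m) → (Finset (Fin m) → Bool) → Finset (Fin m)) :
    ℕ → Finset (Fin m) → ParallelTree m
  | 0, E => output E
  | n + 1, E => round (𝒬 E).card (fun i => ((𝒬 E).equivFin.symm i : Finset (Fin m))) fun a =>
      iterated 𝒬 upd n
        (upd E fun Q => if h : Q ∈ 𝒬 E then a ((𝒬 E).equivFin ⟨Q, h⟩) else false)

variable {𝒬 : Finset (Fin m) → Finset (Finset (Fin m))}
  {upd : Finset (Fin m) → (Finset (Fin m) → Bool) → Finset (Fin m)}

theorem rounds_iterated_le (n : ℕ) (E : Finset (Fin m)) :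
    (iterated 𝒬 upd n E).rounds ≤ n := by
  induction n generalizing E with
  | zero => exact le_rfl
  | succ n ih => exact Nat.succ_le_succ (Finset.sup_le fun a _ => ih _)

theorem queriesPerRound_iterated_le {q : ℕ} (hq : ∀ E, (𝒬 E).card ≤ q) (n : ℕ)
    (E : Finset (Fin m)) : (iterated 𝒬 upd n E).queriesPerRound ≤ q := by
  induction n generalizing E with
  | zero => exact Nat.zero_le _
  | succ n ih => exact max_le (hq E) (Finset.sup_le fun a _ => ih _)

theorem allQueries_iterated {P : Finset (Fin m) → Prop} (hP : ∀ E, ∀ Q ∈ 𝒬 E, P Q) (n : ℕ)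
    (E : Finset (Fin m)) : (iterated 𝒬 upd n E).AllQueries P := by
  induction n generalizing E with
  | zero => exact trivial
  | succ n ih => exact ⟨fun i => hP E _ ((𝒬 E).equivFin.symm i).2, fun a => ih _⟩

/-- If the update depends only on the answers to the submitted sets, the default answer `false` for
all others is never felt, and the tree iterates the update with the true oracle. -/
theorem run_iterated
    (hupd : ∀ E f g, (∀ Q ∈ 𝒬 E, f Q = g Q) → upd E f = upd E g) (f : Finset (Fin m) → Bool)
    (n : ℕ) (E : Finset (Fin m)) :
    (iterated 𝒬 upd n E).run f = (fun E => upd E f)^[n] E := by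
  induction n generalizing E with
  | zero => rfl
  | succ n ih =>
    rw [iterated, run, ih, Function.iterate_succ_apply]
    congr 1
    refine hupd E _ _ fun Q hQ => ?_
    simp [hQ]

end ParallelTree

/-! ### One round: deleting the largest edges of isolated cycles -/

namespace QueryFamilies

variable {m : ℕ}

/-- The members of the families `B |E| l` with `l ∈ [m]`, carried over to `E`. -/
def carried (B : QueryFamilies) (E : Finset (Fin m)) : Finset (Finset (Fin m)) :=
  (Finset.Icc 1 m).biUnion fun l =>
    (B E.card l).image fun S => S.map (E.orderEmbOfFin rfl).toEmbedding

/-- The sets that are queried when `E` is the set of remaining edges. -/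
def queries (B : QueryFamilies) (E : Finset (Fin m)) : Finset (Finset (Fin m)) :=
  Finset.image₂ (· \ ·) (B.carried E) (insert ∅ (Finset.univ.image fun e => {e}))

theorem card_carried_le {B : QueryFamilies} {s : Polynomial ℕ} (hB : B.HasSize s)
    (E : Finset (Fin m)) : (B.carried E).card ≤ m * s.eval m := by
  refine (Finset.card_biUnion_le_card_mul _ _ (s.eval m) fun l _ => ?_).trans (by simp)
  refine Finset.card_image_le.trans ((hB _ _).trans ?_)
  -- With natural coefficients, evaluation is monotone, so `|E| ≤ m` suffices.
  rw [Polynomial.eval_eq_sum, Polynomial.eval_eq_sum]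
  refine Finset.sum_le_sum fun i _ => ?_
  have : E.card ≤ m := by simpa using Finset.card_le_univ E
  exact Nat.mul_le_mul_left _ (Nat.pow_le_pow_left this i)

theorem card_queries_le {B : QueryFamilies} {s : Polynomial ℕ} (hB : B.HasSize s)
    (E : Finset (Fin m)) : (B.queries E).card ≤ m * s.eval m * (m + 1) := by
  refine (Finset.card_image₂_le _ _ _).trans (Nat.mul_le_mul (card_carried_le hB E) ?_)
  refine (Finset.card_insert_le _ _).trans (Nat.succ_le_succ ?_)
  exact Finset.card_image_le.trans (by simp)

theorem provides_of_mem_queries {B : QueryFamilies} {E Q : Finset (Fin m)}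
    (h : Q ∈ B.queries E) : B.Provides Q := by
  obtain ⟨T, hT, D, hD, rfl⟩ := Finset.mem_image₂.1 h
  obtain ⟨l, hl, hT⟩ := Finset.mem_biUnion.1 hT
  obtain ⟨S, hS, rfl⟩ := Finset.mem_image.1 hT
  rw [Finset.mem_Icc] at hl
  refine ⟨E, l, S, D, hl.1, hl.2, hS, ?_, rfl⟩
  rcases Finset.mem_insert.1 hD with rfl | hD
  · simp
  · obtain ⟨e, -, rfl⟩ := Finset.mem_image.1 hD
    simp

theorem mem_queries {B : QueryFamilies} {E S : Finset (Fin m)} (h : S ∈ B.carried E) :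
    S ∈ B.queries E :=
  Finset.mem_image₂.2 ⟨S, h, ∅, by simp, by simp⟩

theorem sdiff_mem_queries {B : QueryFamilies} {E S : Finset (Fin m)} (h : S ∈ B.carried E)
    (e : Fin m) : S \ {e} ∈ B.queries E :=
  Finset.mem_image₂.2 ⟨S, h, {e}, by simp, rfl⟩

/-- According to the oracle `f`, the edge `e` is the largest edge of the only cycle in `S`. -/
def IsTop (f : Finset (Fin m) → Bool) (S : Finset (Fin m)) (e : Fin m) : Prop :=
  e ∈ S ∧ f S = false ∧ f (S \ {e}) = true ∧ ∀ e' ∈ S, e < e' → f (S \ {e'}) = false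

open Classical in
/-- Remove the largest edges of all cycles that have been found. -/
noncomputable def prune (B : QueryFamilies) (E : Finset (Fin m)) (f : Finset (Fin m) → Bool) :
    Finset (Fin m) :=
  {e ∈ E | ¬ ∃ S ∈ B.carried E, IsTop f S e}

theorem mem_prune {B : QueryFamilies} {E : Finset (Fin m)} {f : Finset (Fin m) → Bool}
    {e : Fin m} : e ∈ B.prune E f ↔ e ∈ E ∧ ¬ ∃ S ∈ B.carried E, IsTop f S e := by
  simp only [prune, Finset.mem_filter]

theorem prune_congr (B : QueryFamilies) (E : Finset (Fin m)) (f g : Finset (Fin m) → Bool)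
    (h : ∀ Q ∈ B.queries E, f Q = g Q) : B.prune E f = B.prune E g := by
  ext e
  rw [mem_prune, mem_prune]
  refine and_congr_right fun _ => not_congr (exists_congr fun S => and_congr_right fun hS => ?_)
  simp only [IsTop, h _ (mem_queries hS), h _ (sdiff_mem_queries hS _)]

theorem carried_subset {B : QueryFamilies} {E S : Finset (Fin m)} (h : S ∈ B.carried E) :
    S ⊆ E := by
  obtain ⟨l, -, h⟩ := Finset.mem_biUnion.1 h
  obtain ⟨S, -, rfl⟩ := Finset.mem_image.1 h
  intro e he
  obtain ⟨i, -, rfl⟩ := Finset.mem_map.1 he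
  exact Finset.orderEmbOfFin_mem E rfl i

/-- An edge reported by `IsTop` is spanned by smaller edges. -/
theorem IsTop.mem_closure {M : Matroid (Fin m)} (hM : M.E = Set.univ) {S : Finset (Fin m)}
    {e : Fin m} (h : IsTop (indepOracle M) S e) :
    e ∈ M.closure {e' : Fin m | e' ∈ S ∧ e' < e} := by
  obtain ⟨heS, hS, hSe, htop⟩ := h
  simp only [indepOracle_eq_true_iff, indepOracle_eq_false_iff, Finset.coe_sdiff,
    Finset.coe_singleton] at hS hSe htop
  have hdep : M.Dep (S : Set (Fin m)) := ⟨hS, by simp [hM]⟩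
  have hins : insert e ((S : Set (Fin m)) \ {e}) = S := by simp [heS]
  -- `S` is an independent set plus the single element `e`, so it contains only one circuit.
  have huniq : ∀ C, M.IsCircuit C → C ⊆ S → C = M.fundCircuit e ((S : Set (Fin m)) \ {e}) :=
    fun C hC hCS => hC.eq_fundCircuit_of_subset hSe (by rwa [hins])
  obtain ⟨C, hCS, hC⟩ := hdep.exists_isCircuit_subset
  have heC : e ∈ C := by
    by_contra heC
    exact hC.not_indep (hSe.subset fun f hf => ⟨hCS hf, fun h => heC (h ▸ hf)⟩)
  refine M.closure_subset_closure ?_ (hC.mem_closure_sdiff_singleton_of_mem heC)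
  rintro f ⟨hfC, hfe⟩
  refine ⟨hCS hfC, lt_of_le_of_ne (not_lt.1 fun hlt => ?_) hfe⟩
  -- An element `f > e` of the circuit would meet the only circuit of `S`, making `S \ {f}`
  -- independent against the oracle's answer.
  have hdep' : M.Dep ((S : Set (Fin m)) \ {f}) := ⟨htop f (hCS hfC) hlt, by simp [hM]⟩
  obtain ⟨C', hC'S, hC'⟩ := hdep'.exists_isCircuit_subset
  have h1 : C' = C :=
    (huniq C' hC' (hC'S.trans Set.sdiff_subset)).trans (huniq C hC hCS).symm
  exact (hC'S (h1 ▸ hfC)).2 rfl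

/-- Simultaneous deletion is safe because one linear order is used for all cycles. By induction
along it, each deleted edge lies in the span of smaller edges, which the surviving edges already
span. -/
theorem closure_prune {B : QueryFamilies} {M : Matroid (Fin m)} (hM : M.E = Set.univ)
    {E : Finset (Fin m)} (hE : M.closure E = Set.univ) :
    M.closure (B.prune E (indepOracle M)) = Set.univ := by
  have key : ∀ e, e ∈ E → e ∈ M.closure (B.prune E (indepOracle M)) := by
    intro e
    induction e using WellFoundedLT.induction with
    | ind e ih =>
      intro he
      by_cases h : ∃ S ∈ B.carried E, IsTop (indepOracle M) S e
      · obtain ⟨S, hS, htop⟩ := h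
        refine M.closure_subset_closure_of_subset_closure ?_ (htop.mem_closure hM)
        exact fun f hf => ih f hf.2 (carried_subset hS hf.1)
      · refine M.mem_closure_of_mem' ?_ (by simp [hM])
        exact Finset.mem_coe.2 (mem_prune.2 ⟨he, h⟩)
  rw [Set.eq_univ_iff_forall] at hE ⊢
  exact fun e => M.closure_subset_closure_of_subset_closure (fun f hf => key f hf) (hE e)

/-- The number `g` is only a lower bound for the actual minimum cycle length `l` among the remaining
edges. Since `g ≤ l`, a cycle of length at most `1.01 * g` still lies in the window `[l, 1.01 l]` of
the universal family. -/
theorem exists_isTop {B : QueryFamilies} (hB : QueryFamilies.IsUniversal.{u} B) {V : Type u}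
    {G : Graph V (Fin m)} (hG : G.edgeSet = Set.univ) {E : Finset (Fin m)} {g : ℝ} (hg : 1 ≤ g)
    (hE : ∀ C : Finset (Fin m), G.IsCycle (C : Set (Fin m)) → C ⊆ E → g ≤ C.card)
    {C : Finset (Fin m)} (hC : G.IsCycle (C : Set (Fin m))) (hCE : C ⊆ E)
    (hCg : C.card ≤ 1.01 * g) :
    ∃ e ∈ C, ∃ S ∈ B.carried E, IsTop (indepOracle G.cycleMatroid) S e := by
  let φ := (E.orderEmbOfFin rfl).toEmbedding
  have hφ : Function.Injective φ := φ.injective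
  have hrange : ∀ D : Finset (Fin m), D ⊆ E → ∃ D' : Finset (Fin E.card), D'.map φ = D := by
    intro D hD
    refine ⟨Finset.univ.filter fun i => φ i ∈ D, ?_⟩
    ext e
    simp only [Finset.mem_map, Finset.mem_filter, Finset.mem_univ, true_and]
    constructor
    · rintro ⟨i, hi, rfl⟩; exact hi
    · intro he
      have h1 : e ∈ Set.range (E.orderEmbOfFin rfl) := by
        rw [Finset.range_orderEmbOfFin]; exact hD he
      obtain ⟨i, rfl⟩ := h1
      exact ⟨i, he, rfl⟩
  have hcyc : ∀ D : Finset (Fin E.card), (G.reindex φ).IsCycle (D : Set (Fin E.card)) ↔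
      G.IsCycle ((D.map φ : Finset (Fin m)) : Set (Fin m)) := by
    intro D
    rw [Graph.isCycle_reindex_iff hφ, Finset.coe_map]
  obtain ⟨C₀, rfl⟩ := hrange C hCE
  rw [← hcyc] at hC
  rw [Finset.card_map] at hCg
  obtain ⟨l, hl⟩ : ∃ l, (G.reindex φ).HasMinCycleLength l := by
    have hne : {k : ℕ | ∃ C, (G.reindex φ).IsCycle C ∧ C.ncard = k}.Nonempty := ⟨_, _, hC, rfl⟩
    exact ⟨_, Nat.sInf_mem hne, fun k hk => Nat.sInf_le hk⟩
  have hgl : g ≤ l := by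
    obtain ⟨D, hD, rfl⟩ := hl.1
    obtain ⟨D, rfl⟩ : ∃ D' : Finset (Fin E.card), (D' : Set (Fin E.card)) = D :=
      ⟨D.toFinite.toFinset, by simp⟩
    rw [Set.ncard_coe_finset, ← Finset.card_map φ]
    refine hE _ ((hcyc D).1 hD) fun e he => ?_
    obtain ⟨i, -, rfl⟩ := Finset.mem_map.1 he
    exact Finset.orderEmbOfFin_mem E rfl i
  have hlC : l ≤ (C₀ : Set (Fin E.card)).ncard := hl.2 ⟨_, hC, rfl⟩
  obtain ⟨S, hS, huniq⟩ := hB E.card l V (G.reindex φ) (Graph.reindex_edgeSet _ hG) hl C₀ hC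
    (by exact_mod_cast hlC) (by rw [Set.ncard_coe_finset]; linarith)
  have hCS : C₀ ⊆ S := Finset.coe_subset.1 ((huniq C₀).2 rfl).2
  have hSE : S.map φ ∈ B.carried E := by
    refine Finset.mem_biUnion.2 ⟨l, ?_, Finset.mem_image_of_mem _ hS⟩
    rw [Finset.mem_Icc]
    constructor
    · have : (1 : ℝ) ≤ l := hg.trans hgl
      exact_mod_cast this
    · rw [Set.ncard_coe_finset, ← Finset.card_map φ] at hlC
      exact hlC.trans (by simpa using Finset.card_le_univ (C₀.map φ))
  have huniq' : ∀ D : Set (Fin m), G.IsCycle D → D ⊆ (S.map φ : Finset (Fin m)) →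
      D = (C₀.map φ : Finset (Fin m)) := by
    intro D hD hDS
    obtain ⟨D, rfl⟩ : ∃ D' : Finset (Fin m), (D' : Set (Fin m)) = D :=
      ⟨D.toFinite.toFinset, by simp⟩
    have hDS' := Finset.coe_subset.1 hDS
    obtain ⟨D, rfl⟩ := hrange D (hDS'.trans (carried_subset hSE))
    have h1 := (huniq D).1 ⟨(hcyc D).2 hD, Finset.coe_subset.2 (Finset.map_subset_map.1 hDS')⟩
    rw [Finset.coe_injective h1]
  have hC' := (hcyc C₀).1 hC
  have hCS' : C₀.map φ ⊆ S.map φ := Finset.map_subset_map.2 hCS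
  have hne := Finset.coe_nonempty.1 hC'.nonempty
  -- The deleted edge is the largest edge of `C`: removing it destroys the only cycle in the query,
  -- and removing any larger edge leaves that cycle intact.
  refine ⟨(C₀.map φ).max' hne, Finset.max'_mem _ _, S.map φ, hSE, ?_, ?_, ?_, ?_⟩
  · exact hCS' (Finset.max'_mem _ _)
  · rw [indepOracle_eq_false_iff]
    exact Graph.not_indep_cycleMatroid hC' (Finset.coe_subset.2 hCS')
  · rw [indepOracle_eq_true_iff]
    refine Graph.indep_cycleMatroid hG fun D hD hDS => ?_
    rw [Finset.coe_sdiff] at hDS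
    have h1 := huniq' D hD (hDS.trans Set.sdiff_subset)
    have h2 : (C₀.map φ).max' hne ∈ D := by
      rw [h1]; exact Finset.max'_mem _ _
    exact (hDS h2).2 (by simp)
  · intro e' he' hlt
    rw [indepOracle_eq_false_iff]
    refine Graph.not_indep_cycleMatroid hC' (Finset.coe_subset.2 fun f hf => ?_)
    rw [Finset.mem_sdiff, Finset.mem_singleton]
    refine ⟨hCS' hf, ?_⟩
    rintro rfl
    exact absurd (Finset.le_max' _ _ hf) (not_le.2 hlt)

/-- A surviving cycle shorter than the new bound would have been in the window of the previous round
and would have lost an edge there. -/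
theorem iterate_prune {B : QueryFamilies} (hB : QueryFamilies.IsUniversal.{u} B) {V : Type u}
    {G : Graph V (Fin m)} (hG : G.edgeSet = Set.univ) (n : ℕ) :
    let E := (fun E => B.prune E (indepOracle G.cycleMatroid))^[n] Finset.univ
    G.cycleMatroid.closure E = Set.univ ∧
      ∀ C : Finset (Fin m), G.IsCycle (C : Set (Fin m)) → C ⊆ E → (1.01 : ℝ) ^ n ≤ C.card := by
  have hM : G.cycleMatroid.E = Set.univ := Graph.cycleMatroid_ground.trans hG
  induction n with
  | zero =>
    refine ⟨?_, fun C hC _ => ?_⟩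
    · rw [Function.iterate_zero, id, Finset.coe_univ, ← hM, Matroid.closure_ground]
    · rw [pow_zero]
      exact_mod_cast Finset.card_pos.2 (Finset.coe_nonempty.1 hC.nonempty)
  | succ n ih =>
    simp only [Function.iterate_succ_apply']
    set E := (fun E => B.prune E (indepOracle G.cycleMatroid))^[n] Finset.univ
    refine ⟨closure_prune hM ih.1, fun C hC hCE => ?_⟩
    by_contra hlt
    push Not at hlt
    rw [pow_succ'] at hlt
    obtain ⟨e, heC, hS⟩ := exists_isTop hB hG (one_le_pow₀ (by norm_num)) ih.2 hC
      (fun e he => (mem_prune.1 (hCE he)).1) hlt.le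
    exact (mem_prune.1 (hCE heC)).2 hS

theorem isBase_iterate_prune {B : QueryFamilies} (hB : QueryFamilies.IsUniversal.{u} B)
    {V : Type u} {G : Graph V (Fin m)} (hG : G.edgeSet = Set.univ) {n : ℕ}
    (hn : (m : ℝ) < 1.01 ^ n) :
    G.cycleMatroid.IsBase
      ((fun E => B.prune E (indepOracle G.cycleMatroid))^[n] Finset.univ : Finset (Fin m)) := by
  obtain ⟨h1, h2⟩ := iterate_prune hB hG n
  rw [Matroid.isBase_iff_indep_closure_eq, h1, Graph.cycleMatroid_ground, hG]
  refine ⟨Graph.indep_cycleMatroid hG fun C hC hCE => ?_, rfl⟩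
  obtain ⟨C, rfl⟩ : ∃ D : Finset (Fin m), (D : Set (Fin m)) = C :=
    ⟨C.toFinite.toFinset, by simp⟩
  have h3 := h2 C hC (Finset.coe_subset.1 hCE)
  have h4 : (C.card : ℝ) ≤ m := by
    exact_mod_cast (by simpa using Finset.card_le_univ C)
  linarith

end QueryFamilies

/-! ### Number of rounds and conclusion -/

/-- The number of rounds after which no cycle is left. -/
noncomputable def roundBound (m : ℕ) : ℕ := ⌊Real.log m / Real.log 1.01⌋₊ + 1

theorem lt_pow_roundBound (m : ℕ) : (m : ℝ) < 1.01 ^ roundBound m := by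
  rcases Nat.eq_zero_or_pos m with rfl | hm
  · rw [Nat.cast_zero]; positivity
  have hm' : (0 : ℝ) < m := by exact_mod_cast hm
  have hlog : (0 : ℝ) < Real.log 1.01 := Real.log_pos (by norm_num)
  have h := Nat.lt_floor_add_one (Real.log m / Real.log 1.01)
  rw [div_lt_iff₀ hlog] at h
  rw [← Real.log_lt_log_iff hm' (by positivity), Real.log_pow, roundBound]
  push_cast
  exact h

theorem isBigO_roundBound :
    (fun m => (roundBound m : ℝ)) =O[atTop] (fun m : ℕ => Real.log (m : ℝ)) := by
  have hlog : (0 : ℝ) < Real.log 1.01 := Real.log_pos (by norm_num)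
  refine IsBigO.of_bound ((Real.log 1.01)⁻¹ + 1) ?_
  -- For `m ≥ 3 > e` the logarithm is at least 1 and absorbs the additive constant in `roundBound`.
  filter_upwards [eventually_ge_atTop 3] with m hm
  have h1 : 1 ≤ Real.log m := by
    rw [Real.le_log_iff_exp_le (by positivity)]
    have : (3 : ℝ) ≤ m := by exact_mod_cast hm
    linarith [Real.exp_one_lt_d9]
  have h2 := Nat.floor_le (a := Real.log m / Real.log 1.01) (by positivity)
  rw [Real.norm_of_nonneg (by positivity), Real.norm_of_nonneg (by positivity), roundBound]
  push_cast
  rw [div_eq_mul_inv] at h2 ⊢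
  linarith

theorem mainTheorem1 :
    ∃ (s q : Polynomial ℕ) (k : ℕ) (r : ℕ → ℕ),
      (fun m => (r m : ℝ)) =O[atTop] (fun m => Real.log (m : ℝ)) ∧
      (∃ B : QueryFamilies, QueryFamilies.IsUniversal.{u} B ∧ B.HasSize s) ∧
      ∀ B : QueryFamilies, QueryFamilies.IsUniversal.{u} B → B.HasSize s →
        ∃ A : (m : ℕ) → ParallelTree m, ∀ m : ℕ,
          (A m).rounds ≤ r m ∧
          (A m).queriesPerRound ≤ q.eval m ∧
          (A m).AllQueries (fun Q => Q.card ≤ k ∨ B.Provides Q) ∧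
          ∀ (V : Type u) (G : Graph V (Fin m)), G.edgeSet = Set.univ →
            G.cycleMatroid.IsBase ((A m).run (indepOracle G.cycleMatroid) : Set (Fin m)) := by
  -- The factors of `q` count the values of `l`, the members of a family, and the choices of at most
  -- one removed edge. All queries come from the families, so `k = 0`.
  refine ⟨familySize, Polynomial.X * familySize * (Polynomial.X + 1), 0, roundBound,
    isBigO_roundBound, exists_isUniversal, fun B hB hs => ?_⟩
  refine ⟨fun m => ParallelTree.iterated B.queries B.prune (roundBound m) Finset.univ,
    fun m => ⟨ParallelTree.rounds_iterated_le _ _, ?_, ?_, fun V G hG => ?_⟩⟩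
  · refine ParallelTree.queriesPerRound_iterated_le (fun E => ?_) _ _
    simpa using QueryFamilies.card_queries_le hs E
  · exact ParallelTree.allQueries_iterated
      (fun E Q hQ => Or.inr (QueryFamilies.provides_of_mem_queries hQ)) _ _
  · rw [ParallelTree.run_iterated B.prune_congr]
    exact QueryFamilies.isBase_iterate_prune hB hG (lt_pow_roundBound m)
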